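/- Let $a\in C[0,1]$ with $a(0)=0$ and $a>0$ on $(0,1]$, and put $K:=\sup_{x\in(0,1]}\frac{x|a'(x)|}{a(x)}$. Assume that $a$ is either weakly degenerate (WD), i.e. $a\in C^1(0,1]$ and $K\in(0,1)$, or strongly degenerate (SD), i.e. $a\in C^1[0,1]$ and $K\in[1,2)$. Let $$L^2_{1/a}(0,1)=\Big\{u\in L^2(0,1):\int_0^1\frac{u^2}{a}\,dx<\infty\Big\},\qquad H^2_{1/a}(0,1)=L^2_{1/a}(0,1)\cap H^2_0(0,1),$$ with norms $\|u\|_{L^2_{1/a}}^2=\int_0^1 u^2/a\,dx$ and $\|u\|_{H^2_{1/a}}^2=\|u\|_{L^2_{1/a}}^2+\|u'\|_{L^2}^2+\|u''\|_{L^2}^2$, and let $Au:=au''''$ on $D(A)=\{u\in H^2_{1/a}(0,1): au''''\in L^2_{1/a}(0,1)\}$, with the graph norm. Let $y$ be a classical solution of $$\begin{cases} y_{tt}+a\,y_{xxxx}=0,&(t,x)\in(0,\infty)\times(0,1),\\ y(t,0)=y(t,1)=y_x(t,0)=y_x(t,1)=0,&t>0,\\ y(0,x)=y_0(x),\quad y_t(0,x)=y_1(x),&x\in(0,1),\end{cases}$$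 that is, $y\in C^2([0,\infty);L^2_{1/a}(0,1))\cap C^1([0,\infty);H^2_{1/a}(0,1))\cap C([0,\infty);D(A))$ takes these initial data and satisfies $y_{tt}(t)+Ay(t)=0$ in $L^2_{1/a}(0,1)$ for all $t\ge0$; here $y(t,\cdot)$ denotes the representative that is continuous on $[0,1]$. Then $y(t,\cdot)\in C^2(0,1]$ for every $t\ge 0$ and $y(\cdot,x)$ is differentiable on $[0,\infty)$ for every $x\in[0,1]$ (so that $y_x$, $y_{xx}$, including $y_{xx}(t,1)$, and $y_t$ below are classical derivatives), and for every $T>0$, with $Q_T=(0,T)\times(0,1)$, one has $y_{xx}(\cdot,1)\in L^2(0,T)$, all the integrals below converge, and $$\frac12\int_0^T y_{xx}^2(t,1)\,dt=\int_0^1\Big[y_t\frac{x^2}{a}y_x\Big]_{t=0}^{t=T}dx+\frac12\int_{Q_T}\frac{x}{a}\,y_t^2\Big(2-\frac{x a'}{a}\Big)dx\,dt+3\int_{Q_T}x\,y_{xx}^2\,dx\,dt .$$ -/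

import Mathlib

open MeasureTheory Set Filter Topology
open scoped ContDiff ENNReal

noncomputable section

namespace DegenerateBeam

/-- A coefficient `a : [0,1] → ℝ`, continuous on `[0,1]`, with `a(0) = 0` and `a > 0` on `(0,1]`
(values outside `[0,1]` are irrelevant). -/
structure Coefficient where
  toFun : ℝ → ℝ
  continuousOn : ContinuousOn toFun (Icc 0 1)
  map_zero : toFun 0 = 0
  pos : ∀ x ∈ Ioc (0 : ℝ) 1, 0 < toFun x

instance : CoeFun Coefficient (fun _ => ℝ → ℝ) := ⟨Coefficient.toFun⟩

/-- The derivative `a'` on `[0,1]`, one-sided at the end points. -/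
def Coefficient.deriv (a : Coefficient) (x : ℝ) : ℝ := derivWithin a (Icc 0 1) x

/-- `K` is the (finite) supremum of `x |a'(x)| / a(x)` over `(0,1]`. -/
def Coefficient.IsDegeneracyConstant (a : Coefficient) (K : ℝ) : Prop :=
  IsLUB ((fun x : ℝ => x * |a.deriv x| / a x) '' Ioc 0 1) K

/-- `a` is weakly degenerate at `0`: `a ∈ C[0,1] ∩ C¹(0,1]` and `K ∈ (0,1)`. -/
def Coefficient.WeaklyDegenerate (a : Coefficient) : Prop :=
  ContDiffOn ℝ 1 a (Ioc 0 1) ∧ ∃ K ∈ Ioo (0 : ℝ) 1, a.IsDegeneracyConstant K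

/-- `a` is strongly degenerate at `0`: `a ∈ C¹[0,1]` and `K ∈ [1,2)`. -/
def Coefficient.StronglyDegenerate (a : Coefficient) : Prop :=
  ContDiffOn ℝ 1 a (Icc 0 1) ∧ ∃ K ∈ Ico (1 : ℝ) 2, a.IsDegeneracyConstant K

/-- Lebesgue measure on `(0,1)`. -/
abbrev unitMeasure : Measure ℝ := volume.restrict (Ioo 0 1)

/-- The measure `dx / a` on `(0,1)`. -/
def Coefficient.measure (a : Coefficient) : Measure ℝ :=
  unitMeasure.withDensity (fun x => ENNReal.ofReal (1 / a x))

/-- `L²(0,1)`. -/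
abbrev UnitL2 : Type := Lp ℝ 2 unitMeasure

/-- `L²_{1/a}(0,1)` with its norm `(∫₀¹ u²/a)^{1/2}`. Since `1/a` is bounded below by a positive
constant on `(0,1)`, its elements are automatically in `L²(0,1)`. -/
abbrev Coefficient.L2 (a : Coefficient) : Type := Lp ℝ 2 a.measure

theorem Coefficient.absolutelyContinuous (a : Coefficient) : unitMeasure ≪ a.measure := by
  refine withDensity_absolutelyContinuous' ?_ ?_
  · have hc : ContinuousOn (fun x : ℝ => 1 / a x) (Ioo 0 1) :=
      continuousOn_const.div (a.continuousOn.mono Ioo_subset_Icc_self)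
        (fun x hx => (a.pos x ⟨hx.1, hx.2.le⟩).ne')
    exact (hc.aemeasurable measurableSet_Ioo).ennreal_ofReal
  · refine (ae_restrict_iff' measurableSet_Ioo).2 (Eventually.of_forall fun x hx => ?_)
    have := a.pos x ⟨hx.1, hx.2.le⟩
    simpa using this

/-- `v` is the `k`-th weak derivative of `u` on `(0,1)`. -/
def HasWeakDeriv (k : ℕ) (u v : ℝ → ℝ) : Prop :=
  LocallyIntegrableOn u (Ioo 0 1) ∧ LocallyIntegrableOn v (Ioo 0 1) ∧
    ∀ φ : ℝ → ℝ, ContDiff ℝ ∞ φ → HasCompactSupport φ → tsupport φ ⊆ Ioo 0 1 →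
      ∫ x in Ioo 0 1, u x * iteratedDeriv k φ x = (-1) ^ k * ∫ x in Ioo 0 1, v x * φ x

/-- `u` has a representative which is continuous on `[0,1]` and vanishes at `0` and at `1`. -/
def VanishesAtEndpoints (u : ℝ → ℝ) : Prop :=
  ∃ g : ℝ → ℝ, ContinuousOn g (Icc 0 1) ∧ g 0 = 0 ∧ g 1 = 0 ∧ u =ᵐ[unitMeasure] g

theorem tsupport_iteratedDeriv (k : ℕ) (φ : ℝ → ℝ) :
    tsupport (iteratedDeriv k φ) ⊆ tsupport φ := by
  induction k with
  | zero => simp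
  | succ k ih =>
    rw [iteratedDeriv_succ]
    exact (tsupport_deriv_subset (𝕜 := ℝ)).trans ih

theorem integrableOn_mul_test {u ψ : ℝ → ℝ} (hu : LocallyIntegrableOn u (Ioo 0 1))
    (hψ : Continuous ψ) (hc : IsCompact (tsupport ψ)) (hs : tsupport ψ ⊆ Ioo (0 : ℝ) 1) :
    IntegrableOn (fun x => u x * ψ x) (Ioo 0 1) := by
  have h1 : IntegrableOn (fun x => u x * ψ x) (tsupport ψ) :=
    (hu.integrableOn_compact_subset hs hc).mul_continuousOn hψ.continuousOn hc
  have h2 : Integrable (fun x => u x * ψ x) := by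
    refine (integrableOn_iff_integrable_of_support_subset ?_).1 h1
    intro x hx
    exact subset_tsupport ψ (right_ne_zero_of_mul hx)
  exact h2.integrableOn

theorem HasWeakDeriv.congr {k : ℕ} {u v u' v' : ℝ → ℝ} (h : HasWeakDeriv k u v)
    (hu : u =ᵐ[unitMeasure] u') (hv : v =ᵐ[unitMeasure] v') : HasWeakDeriv k u' v' := by
  refine ⟨h.1.congr hu, h.2.1.congr hv, fun φ h1 h2 h3 => ?_⟩
  have e1 : ∫ x in Ioo 0 1, u x * iteratedDeriv k φ x
      = ∫ x in Ioo 0 1, u' x * iteratedDeriv k φ x :=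
    integral_congr_ae (hu.mono fun x hx => by simp [hx])
  have e2 : ∫ x in Ioo 0 1, v x * φ x = ∫ x in Ioo 0 1, v' x * φ x :=
    integral_congr_ae (hv.mono fun x hx => by simp [hx])
  rw [← e1, ← e2]
  exact h.2.2 φ h1 h2 h3

theorem HasWeakDeriv.zero (k : ℕ) : HasWeakDeriv k (fun _ => 0) (fun _ => 0) :=
  ⟨locallyIntegrableOn_zero, locallyIntegrableOn_zero, fun φ _ _ _ => by simp⟩

theorem HasWeakDeriv.add {k : ℕ} {u v u' v' : ℝ → ℝ} (h : HasWeakDeriv k u v)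
    (h' : HasWeakDeriv k u' v') : HasWeakDeriv k (u + u') (v + v') := by
  refine ⟨h.1.add h'.1, h.2.1.add h'.2.1, fun φ h1 h2 h3 => ?_⟩
  have hk : tsupport (iteratedDeriv k φ) ⊆ Ioo 0 1 := (tsupport_iteratedDeriv k φ).trans h3
  have hck : IsCompact (tsupport (iteratedDeriv k φ)) :=
    h2.isCompact.of_isClosed_subset (isClosed_tsupport _) (tsupport_iteratedDeriv k φ)
  have hd : Continuous (iteratedDeriv k φ) :=
    h1.continuous_iteratedDeriv k (by exact_mod_cast le_top)
  simp only [Pi.add_apply, add_mul]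
  rw [integral_add (integrableOn_mul_test h.1 hd hck hk) (integrableOn_mul_test h'.1 hd hck hk),
    integral_add (integrableOn_mul_test h.2.1 h1.continuous h2 h3)
      (integrableOn_mul_test h'.2.1 h1.continuous h2 h3), h.2.2 φ h1 h2 h3, h'.2.2 φ h1 h2 h3]
  ring

theorem HasWeakDeriv.smul {k : ℕ} {u v : ℝ → ℝ} (c : ℝ) (h : HasWeakDeriv k u v) :
    HasWeakDeriv k (c • u) (c • v) := by
  refine ⟨h.1.smul c, h.2.1.smul c, fun φ h1 h2 h3 => ?_⟩
  simp only [Pi.smul_apply, smul_eq_mul, mul_assoc]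
  rw [integral_const_mul, integral_const_mul, h.2.2 φ h1 h2 h3]
  ring

theorem VanishesAtEndpoints.congr {u u' : ℝ → ℝ} (h : VanishesAtEndpoints u)
    (hu : u =ᵐ[unitMeasure] u') : VanishesAtEndpoints u' := by
  obtain ⟨g, h1, h2, h3, h4⟩ := h
  exact ⟨g, h1, h2, h3, hu.symm.trans h4⟩

theorem VanishesAtEndpoints.zero : VanishesAtEndpoints (fun _ => 0) :=
  ⟨fun _ => 0, continuousOn_const, rfl, rfl, EventuallyEq.rfl⟩

theorem VanishesAtEndpoints.add {u u' : ℝ → ℝ} (h : VanishesAtEndpoints u)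
    (h' : VanishesAtEndpoints u') : VanishesAtEndpoints (u + u') := by
  obtain ⟨g, h1, h2, h3, h4⟩ := h
  obtain ⟨g', h1', h2', h3', h4'⟩ := h'
  exact ⟨g + g', h1.add h1', by simp [h2, h2'], by simp [h3, h3'], h4.add h4'⟩

theorem VanishesAtEndpoints.smul {u : ℝ → ℝ} (c : ℝ) (h : VanishesAtEndpoints u) :
    VanishesAtEndpoints (c • u) := by
  obtain ⟨g, h1, h2, h3, h4⟩ := h
  exact ⟨c • g, h1.const_smul c, by simp [h2], by simp [h3], h4.const_smul c⟩

/-- `H²_{1/a}(0,1) = L²_{1/a}(0,1) ∩ H²₀(0,1)`. An element `u` is stored as `(u, u', u'')`, so that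
the norm inherited from `L²_{1/a} × L² × L²` (the maximum of the three norms) is equivalent to the
norm `(‖u‖²_{L²_{1/a}} + ‖u'‖²_{L²} + ‖u''‖²_{L²})^{1/2}`. -/
def Coefficient.H2 (a : Coefficient) : Submodule ℝ (a.L2 × UnitL2 × UnitL2) where
  carrier := {p | HasWeakDeriv 1 p.1 p.2.1 ∧ HasWeakDeriv 2 p.1 p.2.2 ∧
    VanishesAtEndpoints p.1 ∧ VanishesAtEndpoints p.2.1}
  zero_mem' := by
    have e1 := (a.absolutelyContinuous.ae_eq (Lp.coeFn_zero ℝ 2 a.measure)).symm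
    have e2 := (Lp.coeFn_zero ℝ 2 unitMeasure).symm
    exact ⟨(HasWeakDeriv.zero 1).congr e1 e2, (HasWeakDeriv.zero 2).congr e1 e2,
      VanishesAtEndpoints.zero.congr e1, VanishesAtEndpoints.zero.congr e2⟩
  add_mem' := by
    rintro p q ⟨h1, h2, h3, h4⟩ ⟨k1, k2, k3, k4⟩
    have e1 := (a.absolutelyContinuous.ae_eq (Lp.coeFn_add p.1 q.1)).symm
    have e2 := (Lp.coeFn_add p.2.1 q.2.1).symm
    have e3 := (Lp.coeFn_add p.2.2 q.2.2).symm
    exact ⟨(h1.add k1).congr e1 e2, (h2.add k2).congr e1 e3, (h3.add k3).congr e1,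
      (h4.add k4).congr e2⟩
  smul_mem' := by
    rintro c p ⟨h1, h2, h3, h4⟩
    have e1 := (a.absolutelyContinuous.ae_eq (Lp.coeFn_smul c p.1)).symm
    have e2 := (Lp.coeFn_smul c p.2.1).symm
    have e3 := (Lp.coeFn_smul c p.2.2).symm
    exact ⟨(h1.smul c).congr e1 e2, (h2.smul c).congr e1 e3, (h3.smul c).congr e1,
      (h4.smul c).congr e2⟩

/-- `D(A) = {u ∈ H²_{1/a}(0,1) : a u'''' ∈ L²_{1/a}(0,1)}`, where `A u = a u''''`. An element `u` is
stored as `(u, A u)`, so that the inherited norm is (equivalent to) the graph norm. -/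
def Coefficient.D (a : Coefficient) : Submodule ℝ (a.H2 × a.L2) where
  carrier := {p | HasWeakDeriv 4 p.1.1.1 (fun x => p.2 x / a x)}
  zero_mem' := by
    have e1 := (a.absolutelyContinuous.ae_eq (Lp.coeFn_zero ℝ 2 a.measure)).symm
    refine (HasWeakDeriv.zero 4).congr e1 (e1.mono fun x hx => ?_)
    have hx' : (0 : a.L2) x = 0 := hx.symm
    change (0 : ℝ) = (0 : a.L2) x / a x
    rw [hx', zero_div]
  add_mem' := by
    intro p q hp hq
    have e1 := (a.absolutelyContinuous.ae_eq (Lp.coeFn_add p.1.1.1 q.1.1.1)).symm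
    have e2 := (a.absolutelyContinuous.ae_eq (Lp.coeFn_add p.2 q.2)).symm
    refine (HasWeakDeriv.add hp hq).congr e1 (e2.mono fun x hx => ?_)
    simp only [Pi.add_apply, Prod.snd_add] at hx ⊢
    rw [← hx, add_div]
  smul_mem' := by
    intro c p hp
    have e1 := (a.absolutelyContinuous.ae_eq (Lp.coeFn_smul c p.1.1.1)).symm
    have e2 := (a.absolutelyContinuous.ae_eq (Lp.coeFn_smul c p.2)).symm
    refine (HasWeakDeriv.smul c hp).congr e1 (e2.mono fun x hx => ?_)
    simp only [Pi.smul_apply, smul_eq_mul, Prod.smul_snd] at hx ⊢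
    rw [← hx, mul_div_assoc]

/-- The operator `A : D(A) → L²_{1/a}(0,1)`, `A u = a u''''`. -/
def Coefficient.A (a : Coefficient) (u : a.D) : a.L2 := u.1.2

/-- `y` is a classical solution of

* `y_tt + a y_xxxx = 0` in `(0,∞) × (0,1)`,
* `y(t,0) = y(t,1) = y_x(t,0) = y_x(t,1) = 0`,
* `y(0,·) = y₀`, `y_t(0,·) = y₁`,

that is, `y ∈ C²([0,∞); L²_{1/a}) ∩ C¹([0,∞); H²_{1/a}) ∩ C([0,∞); D(A))`, and the equation holds
in `L²_{1/a}` for all `t ≥ 0`. The boundary conditions are contained in the space `H²_{1/a}`. The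
curves `Y`, `Z`, `W` are the curve `t ↦ y(t,·)` seen in `L²_{1/a}`, `H²_{1/a}` and `D(A)`; the
function `y(t,·)` itself is the representative that is continuous on `[0,1]`. -/
def Coefficient.IsClassicalSolution (a : Coefficient) (y₀ y₁ : ℝ → ℝ) (y : ℝ → ℝ → ℝ) : Prop :=
  (∀ t, 0 ≤ t → ContinuousOn (y t) (Icc 0 1)) ∧
  ∃ (Y : ℝ → a.L2) (Z : ℝ → a.H2) (W : ℝ → a.D),
    (∀ t, 0 ≤ t → Y t =ᵐ[unitMeasure] y t) ∧
    (∀ t, 0 ≤ t → (Z t).1.1 = Y t) ∧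
    (∀ t, 0 ≤ t → (W t).1.1 = Z t) ∧
    ContDiffOn ℝ 2 Y (Ici 0) ∧
    ContDiffOn ℝ 1 Z (Ici 0) ∧
    ContinuousOn W (Ici 0) ∧
    (∀ t, 0 ≤ t → iteratedDerivWithin 2 Y (Ici 0) t + a.A (W t) = 0) ∧
    Y 0 =ᵐ[unitMeasure] y₀ ∧
    (derivWithin Y (Ici 0) 0 : a.L2) =ᵐ[unitMeasure] y₁

/-- The time derivative `y_t(t,x)`, one-sided at `t = 0`. -/
def dt (y : ℝ → ℝ → ℝ) (t x : ℝ) : ℝ := derivWithin (fun s => y s x) (Ici 0) t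

/-- The space derivative `y_x(t,x)` on `[0,1]`, one-sided at the end points. -/
def dx (y : ℝ → ℝ → ℝ) (t x : ℝ) : ℝ := derivWithin (y t) (Icc 0 1) x

/-- The second space derivative `y_xx(t,x)` on `[0,1]`, one-sided at the end points. -/
def dxx (y : ℝ → ℝ → ℝ) (t x : ℝ) : ℝ := derivWithin (dx y t) (Icc 0 1) x

end DegenerateBeam

end

/-!
The identity is the multiplier method applied with the multiplier `x² y_x / a`. Put
`E(t) = ∫₀¹ y_t (x² / a) y_x dx`. Since `y_tt = -a y_xxxx`,
`E'(t) = ∫ y_t (x² / a) y_tx - ∫ x² y_x y_xxxx`. The first integral is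
`-1/2 ∫ (x / a) (2 - x a' / a) y_t²` by one integration by parts
(`integral_mul_sq_div_mul_deriv`), the second one is `3 ∫ x y_xx² - y_xx(t,1)² / 2` by repeated
integration by parts (`integral_load_mul`); integrating in time over `(0,T)` gives the claim
(`inner_sub_inner`).

What has to be justified is the regularity of `y` and the vanishing of the boundary terms at the
degenerate point `0`. Both degeneracy assumptions give `x |a'| ≤ 2 a`, so that `a / x²` is
nonincreasing and `x² / a` is bounded (`sq_div_le`). Hence, for `w = A u ∈ L²_{1/a}`, Cauchy-Schwarz
bounds the primitive `∫ₓ¹ w / a` of `u''''` by a multiple of `x^(-1/2)`, which is integrable. The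
second derivative of `u ∈ D(A)` is therefore given by an explicit formula in terms of `w`, the
bending moment `a.bending w`: it is continuous on `[0,1]`, bounded by a multiple of the norm of `w`,
and its derivative is `O(x^(-1/2))` (`ae_eq_bending`, `abs_bending_le`, `abs_tailPrim_le`). Thus
the boundary terms at `0` vanish, and the continuity of `t ↦ A y(t)` in `L²_{1/a}` makes `y_xx`
jointly continuous and bounded on `(0,T) × (0,1)`.

The velocity `y_t(t,·)` lies in `H²_{1/a}`, so it is `O(x)`; this makes `y_t² x / a` bounded.
Finally `E(t)` is the inner product in `L²_{1/a}` of `y_t` with `x² y_x`, where multiplication by `x²`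
is a bounded operator `L² → L²_{1/a}` (`mulSq`), so `E` may be differentiated in the abstract
spaces.
-/

namespace DegenerateBeam

/-! ### Primitives and integration by parts -/

/-- Integration by parts for two functions that are primitives of integrable functions. -/
theorem integral_mul_add_mul_of_primitive {F f G g : ℝ → ℝ} {p q : ℝ}
    (hf : IntervalIntegrable f volume p q) (hg : IntervalIntegrable g volume p q)
    (hF : ∀ x ∈ uIcc p q, F x = F p + ∫ s in p..x, f s)
    (hG : ∀ x ∈ uIcc p q, G x = G p + ∫ s in p..x, g s) :
    ∫ x in p..q, (f x * G x + F x * g x) = F q * G q - F p * G p := by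
  have hAC : ∀ (c : ℝ) {k : ℝ → ℝ}, IntervalIntegrable k volume p q →
      AbsolutelyContinuousOnInterval (fun x => c + ∫ s in p..x, k s) p q := fun c k hk =>
    (((contDiff_const (c := c)).contDiffOn (s := uIcc p q) (n := 1)
      ).absolutelyContinuousOnInterval).add
      (hk.absolutelyContinuousOnInterval_intervalIntegral left_mem_uIcc)
  have h := AbsolutelyContinuousOnInterval.integral_deriv_mul_eq_sub (hAC (F p) hf) (hAC (G p) hg)
  rw [hF q right_mem_uIcc, hG q right_mem_uIcc]
  simp only [intervalIntegral.integral_same, add_zero] at h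
  rw [← h]
  refine intervalIntegral.integral_congr_ae ?_
  filter_upwards [hf.ae_hasDerivAt_integral, hg.ae_hasDerivAt_integral] with x h1 h2 hx
  have hx' := uIoc_subset_uIcc hx
  rw [((h1 hx' p left_mem_uIcc).const_add (F p)).deriv,
    ((h2 hx' p left_mem_uIcc).const_add (G p)).deriv, hF x hx', hG x hx']

/-! ### Test functions and weak derivatives -/

/-- Smooth functions with compact support in `(0,1)`. -/
structure IsTest (φ : ℝ → ℝ) : Prop where
  contDiff : ContDiff ℝ ∞ φ
  hasCompactSupport : HasCompactSupport φ
  tsupport_subset : tsupport φ ⊆ Ioo 0 1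

namespace IsTest

variable {φ : ℝ → ℝ}

theorem deriv (h : IsTest φ) : IsTest (deriv φ) where
  contDiff := (contDiff_infty_iff_deriv.1 h.contDiff).2
  hasCompactSupport := h.hasCompactSupport.deriv
  tsupport_subset := (tsupport_deriv_subset (𝕜 := ℝ)).trans h.tsupport_subset

theorem hasDerivAt (h : IsTest φ) (x : ℝ) : HasDerivAt φ (_root_.deriv φ x) x :=
  ((contDiff_infty_iff_deriv.1 h.contDiff).1 x).hasDerivAt

theorem continuous (h : IsTest φ) : Continuous φ := h.contDiff.continuous

theorem add_smul {ψ : ℝ → ℝ} (h : IsTest φ) (h' : IsTest ψ) (c : ℝ) :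
    IsTest (fun x => φ x + c * ψ x) where
  contDiff := h.contDiff.add (contDiff_const.mul h'.contDiff)
  hasCompactSupport := h.hasCompactSupport.add h'.hasCompactSupport.mul_left
  tsupport_subset := (tsupport_add φ (fun x => c * ψ x)).trans
    (union_subset h.tsupport_subset
      ((tsupport_mul_subset_right (f := fun _ => c) (g := ψ)).trans h'.tsupport_subset))

theorem exists_zero_outside (h : IsTest φ) :
    ∃ p q : ℝ, 0 < p ∧ p < q ∧ q < 1 ∧ ∀ x, x ∉ Icc p q → φ x = 0 := by
  rcases (tsupport φ).eq_empty_or_nonempty with he | hne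
  · refine ⟨1 / 3, 1 / 2, by norm_num, by norm_num, by norm_num, fun x _ => ?_⟩
    exact image_eq_zero_of_notMem_tsupport (by simp [he])
  · obtain ⟨p, hp, hp'⟩ := h.hasCompactSupport.isCompact.exists_isLeast hne
    obtain ⟨q, hq, hq'⟩ := h.hasCompactSupport.isCompact.exists_isGreatest hne
    have h1 := h.tsupport_subset hp
    have h2 := h.tsupport_subset hq
    have h3 := hp' hq
    refine ⟨p / 2, q, by linarith [h1.1], by linarith [h1.1], h2.2, fun x hx => ?_⟩
    refine image_eq_zero_of_notMem_tsupport fun hx' => hx ⟨?_, hq' hx'⟩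
    linarith [hp' hx', h1.1]

theorem zero_of_notMem (h : IsTest φ) {x : ℝ} (hx : x ∉ Ioo (0 : ℝ) 1) : φ x = 0 :=
  image_eq_zero_of_notMem_tsupport fun h' => hx (h.tsupport_subset h')

theorem integral_eq (h : IsTest φ) : ∫ x in (0 : ℝ)..1, φ x = ∫ x, φ x := by
  rw [intervalIntegral.integral_of_le zero_le_one, integral_Ioc_eq_integral_Ioo]
  exact setIntegral_eq_integral_of_forall_compl_eq_zero fun x hx => h.zero_of_notMem hx

theorem eq_primitive (h : IsTest φ) (p x : ℝ) : φ x = φ p + ∫ s in p..x, _root_.deriv φ s := by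
  rw [intervalIntegral.integral_eq_sub_of_hasDerivAt (fun s _ => h.hasDerivAt s)
    (h.deriv.continuous.intervalIntegrable _ _)]
  ring

/-- A test function with integral zero is the derivative of a test function. -/
theorem exists_primitive (h : IsTest φ) (h0 : ∫ x, φ x = 0) :
    ∃ ψ, IsTest ψ ∧ _root_.deriv ψ = φ := by
  obtain ⟨p, q, hp, hpq, hq, hz⟩ := h.exists_zero_outside
  have hd : ∀ x, HasDerivAt (fun x => ∫ s in (0 : ℝ)..x, φ s) (φ x) x := fun x =>
    h.continuous.integral_hasStrictDerivAt 0 x |>.hasDerivAt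
  have hdf : _root_.deriv (fun x => ∫ s in (0 : ℝ)..x, φ s) = φ := funext fun x => (hd x).deriv
  have hsupp : tsupport (fun x => ∫ s in (0 : ℝ)..x, φ s) ⊆ Icc p q := by
    refine closure_minimal (fun x hx => ?_) isClosed_Icc
    by_contra hx'
    refine hx ?_
    rcases lt_or_ge x p with hxp | hxp
    · refine intervalIntegral.integral_zero_ae (Eventually.of_forall fun s hs => hz s fun hs' => ?_)
      rw [mem_uIoc] at hs
      rcases hs with hs | hs <;> linarith [hs'.1, hs.1, hs.2]
    · have hxq : q < x := by
        by_contra hc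
        exact hx' ⟨hxp, not_lt.1 hc⟩
      have h1 : ∫ s in (1 : ℝ)..x, φ s = 0 := by
        refine intervalIntegral.integral_zero_ae
          (Eventually.of_forall fun s hs => hz s fun hs' => ?_)
        rw [mem_uIoc] at hs
        rcases hs with hs | hs <;> linarith [hs'.2, hs.1, hs.2]
      change ∫ s in (0 : ℝ)..x, φ s = 0
      rw [← intervalIntegral.integral_add_adjacent_intervals
        (h.continuous.intervalIntegrable 0 1) (h.continuous.intervalIntegrable 1 x), h1,
        h.integral_eq, h0, add_zero]
  refine ⟨fun x => ∫ s in (0 : ℝ)..x, φ s, ⟨?_, ?_, ?_⟩, hdf⟩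
  · refine contDiff_infty_iff_deriv.2 ⟨fun x => (hd x).differentiableAt, ?_⟩
    rw [hdf]
    exact h.contDiff
  · exact isCompact_Icc.of_isClosed_subset (isClosed_tsupport _) hsupp
  · exact hsupp.trans fun x hx => ⟨hp.trans_le hx.1, hx.2.trans_lt hq⟩

theorem integrableOn_mul (h : IsTest φ) {u : ℝ → ℝ} (hu : LocallyIntegrableOn u (Ioo 0 1)) :
    IntegrableOn (fun x => u x * φ x) (Ioo 0 1) :=
  integrableOn_mul_test hu h.continuous h.hasCompactSupport.isCompact h.tsupport_subset

end IsTest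

theorem exists_isTest_integral_eq_one : ∃ ρ : ℝ → ℝ, IsTest ρ ∧ ∫ x, ρ x = 1 := by
  let f : ContDiffBump (1 / 2 : ℝ) := ⟨1 / 8, 1 / 4, by norm_num, by norm_num⟩
  refine ⟨f.normed volume, ⟨f.contDiff_normed, f.hasCompactSupport_normed, ?_⟩, f.integral_normed⟩
  rw [f.tsupport_normed_eq, Real.closedBall_eq_Icc]
  intro x hx
  have h1 : f.rOut = 1 / 4 := rfl
  rw [h1] at hx
  exact ⟨by linarith [hx.1], by linarith [hx.2]⟩

/-- A locally integrable function on `(0,1)` whose weak derivative is zero is constant. -/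
theorem exists_ae_eq_const {g : ℝ → ℝ} (hg : LocallyIntegrableOn g (Ioo 0 1))
    (h : ∀ φ, IsTest φ → ∫ x in Ioo 0 1, g x * deriv φ x = 0) :
    ∃ c : ℝ, g =ᵐ[unitMeasure] fun _ => c := by
  obtain ⟨ρ, hρ, hρ1⟩ := exists_isTest_integral_eq_one
  set c := ∫ x in Ioo 0 1, g x * ρ x with hc
  refine ⟨c, ?_⟩
  -- `φ - (∫ φ) ρ` is the derivative of a test function
  have key : ∀ᵐ x, x ∈ Ioo (0 : ℝ) 1 → g x - c = 0 := by
    refine isOpen_Ioo.ae_eq_zero_of_integral_contDiff_smul_eq_zero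
      (hg.sub (locallyIntegrableOn_const c)) fun φ h1 h2 h3 => ?_
    have hφ : IsTest φ := ⟨h1, h2, h3⟩
    have hφi : Integrable φ := hφ.continuous.integrable_of_hasCompactSupport h2
    have hρi : Integrable ρ := hρ.continuous.integrable_of_hasCompactSupport hρ.hasCompactSupport
    obtain ⟨ψ, hψ, hψd⟩ := (hφ.add_smul hρ (-∫ x, φ x)).exists_primitive (by
      rw [integral_add hφi (hρi.const_mul _), integral_const_mul, hρ1]
      ring)
    have e := h ψ hψ
    have e1 : ∫ x in Ioo 0 1, g x * deriv ψ x
        = (∫ x in Ioo 0 1, g x * φ x) - (∫ x, φ x) * c := by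
      rw [hc, ← integral_const_mul, ← integral_sub (hφ.integrableOn_mul hg)
        ((hρ.integrableOn_mul hg).const_mul _)]
      refine integral_congr_ae (Eventually.of_forall fun x => ?_)
      simp only [hψd]
      ring
    have e2 : ∫ x, φ x • (g x - c) = ∫ x in Ioo 0 1, (g x * φ x - c * φ x) := by
      rw [← setIntegral_eq_integral_of_forall_compl_eq_zero (s := Ioo (0 : ℝ) 1)]
      · refine integral_congr_ae (Eventually.of_forall fun x => ?_)
        simp only [smul_eq_mul]
        ring
      · intro x hx
        simp [hφ.zero_of_notMem hx]
    have e3 : ∫ x in Ioo 0 1, φ x = ∫ x, φ x :=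
      setIntegral_eq_integral_of_forall_compl_eq_zero fun x hx => hφ.zero_of_notMem hx
    rw [e2, integral_sub (hφ.integrableOn_mul hg) (hφi.integrableOn.const_mul c),
      integral_const_mul, e3]
    linarith
  refine (ae_restrict_iff' measurableSet_Ioo).2 (key.mono fun x hx hx' => ?_)
  linarith [hx hx']

theorem integral_id_mul_deriv_test {φ : ℝ → ℝ} (hφ : IsTest φ) :
    ∫ x in Ioo 0 1, x * deriv φ x = -∫ x in Ioo 0 1, φ x := by
  have hi : IntervalIntegrable (fun x => x * deriv φ x) volume 0 1 :=
    (continuous_id.mul hφ.deriv.continuous).intervalIntegrable _ _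
  have h := integral_mul_add_mul_of_primitive (F := fun x => x) (f := fun _ => 1) (G := φ)
    (g := deriv φ) (p := 0) (q := 1) intervalIntegrable_const
    (hφ.deriv.continuous.intervalIntegrable _ _) (fun x _ => by simp)
    (fun x _ => hφ.eq_primitive 0 x)
  rw [hφ.zero_of_notMem (by simp), hφ.zero_of_notMem (by simp),
    intervalIntegral.integral_add (by simpa using hφ.continuous.intervalIntegrable _ _) hi] at h
  simp only [intervalIntegral.integral_of_le zero_le_one, integral_Ioc_eq_integral_Ioo,
    one_mul] at h
  linarith

/-- A locally integrable function on `(0,1)` whose second weak derivative is zero is affine. -/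
theorem exists_ae_eq_affine {g : ℝ → ℝ} (hg : LocallyIntegrableOn g (Ioo 0 1))
    (h : ∀ φ, IsTest φ → ∫ x in Ioo 0 1, g x * deriv (deriv φ) x = 0) :
    ∃ α β : ℝ, g =ᵐ[unitMeasure] fun x => α + β * x := by
  obtain ⟨ρ, hρ, hρ1⟩ := exists_isTest_integral_eq_one
  -- the slope is the weak derivative of `g` tested against `ρ`
  set b := -∫ x in Ioo 0 1, g x * deriv ρ x with hb
  have hid : LocallyIntegrableOn (fun x : ℝ => b * x) (Ioo 0 1) :=
    (continuous_const.mul continuous_id).continuousOn.locallyIntegrableOn measurableSet_Ioo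
  have key : ∀ φ, IsTest φ → ∫ x in Ioo 0 1, (g x - b * x) * deriv φ x = 0 := by
    intro φ hφ
    have hφi : Integrable φ := hφ.continuous.integrable_of_hasCompactSupport hφ.hasCompactSupport
    have hρi : Integrable ρ := hρ.continuous.integrable_of_hasCompactSupport hρ.hasCompactSupport
    obtain ⟨ψ, hψ, hψd⟩ := (hφ.add_smul hρ (-∫ x, φ x)).exists_primitive (by
      rw [integral_add hφi (hρi.const_mul _), integral_const_mul, hρ1]
      ring)
    have hdd : deriv (deriv ψ) = fun x => deriv φ x + (-∫ x, φ x) * deriv ρ x := by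
      rw [hψd]
      exact funext fun x => ((hφ.hasDerivAt x).add ((hρ.hasDerivAt x).const_mul _)).deriv
    have e := h ψ hψ
    have e1 : ∫ x in Ioo 0 1, g x * deriv (deriv ψ) x
        = (∫ x in Ioo 0 1, g x * deriv φ x) + (∫ x, φ x) * b := by
      rw [hb, mul_neg, ← integral_const_mul, ← sub_eq_add_neg,
        ← integral_sub (hφ.deriv.integrableOn_mul hg)
        ((hρ.deriv.integrableOn_mul hg).const_mul _)]
      refine integral_congr_ae (Eventually.of_forall fun x => ?_)
      simp only [hdd]
      ring
    have e3 : ∫ x in Ioo 0 1, φ x = ∫ x, φ x :=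
      setIntegral_eq_integral_of_forall_compl_eq_zero fun x hx => hφ.zero_of_notMem hx
    have e4 := integral_id_mul_deriv_test hφ
    simp only [sub_mul]
    rw [integral_sub (hφ.deriv.integrableOn_mul hg) (hφ.deriv.integrableOn_mul hid)]
    simp only [mul_assoc]
    rw [integral_const_mul, e4, e3]
    linarith
  obtain ⟨c, hc⟩ := exists_ae_eq_const (hg.sub hid) key
  exact ⟨c, b, hc.mono fun x hx => by simp only [Pi.sub_apply] at hx; linarith⟩

/-- The primitive `∫₀ˣ f` of a function on `(0,1)`. -/
noncomputable def prim (f : ℝ → ℝ) (x : ℝ) : ℝ := ∫ s in (0 : ℝ)..x, f s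

theorem prim_zero (f : ℝ → ℝ) : prim f 0 = 0 := intervalIntegral.integral_same

theorem intervalIntegrable_unit {f : ℝ → ℝ} (hf : Integrable f unitMeasure) {x y : ℝ}
    (hx : x ∈ Icc (0 : ℝ) 1) (hy : y ∈ Icc (0 : ℝ) 1) : IntervalIntegrable f volume x y := by
  have h : IntervalIntegrable f volume 0 1 :=
    (intervalIntegrable_iff_integrableOn_Ioo_of_le zero_le_one).2 hf
  refine h.mono_set ?_
  rw [uIcc_of_le zero_le_one]
  exact uIcc_subset_Icc hx hy

theorem continuousOn_prim {f : ℝ → ℝ} (hf : Integrable f unitMeasure) :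
    ContinuousOn (prim f) (Icc 0 1) := by
  have h : IntegrableOn f (uIcc 0 1) := by
    rw [uIcc_of_le zero_le_one, integrableOn_Icc_iff_integrableOn_Ioo]
    exact hf
  have := intervalIntegral.continuousOn_primitive_interval h
  rwa [uIcc_of_le zero_le_one] at this

theorem prim_congr {f g : ℝ → ℝ} (h : f =ᵐ[unitMeasure] g) {x : ℝ} (hx : x ∈ Icc (0 : ℝ) 1) :
    prim f x = prim g x := by
  refine intervalIntegral.integral_congr_ae_restrict ?_
  rw [uIoc_of_le hx.1, ← restrict_Ioo_eq_restrict_Ioc]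
  exact ae_restrict_of_ae_restrict_of_subset (Ioo_subset_Ioo_right hx.2) h

theorem eqOn_of_ae_eq_unit {f g : ℝ → ℝ} (h : f =ᵐ[unitMeasure] g)
    (hf : ContinuousOn f (Icc 0 1)) (hg : ContinuousOn g (Icc 0 1)) : EqOn f g (Icc 0 1) := by
  refine Measure.eqOn_Icc_of_ae_eq volume zero_ne_one ?_ hf hg
  rwa [← restrict_Ioo_eq_restrict_Icc]

theorem integral_prim_mul_deriv_test {f φ : ℝ → ℝ} (hf : Integrable f unitMeasure)
    (hφ : IsTest φ) : ∫ x in Ioo 0 1, prim f x * deriv φ x = -∫ x in Ioo 0 1, f x * φ x := by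
  have hfi := intervalIntegrable_unit hf (x := 0) (y := 1) (by simp) (by simp)
  have hc : ContinuousOn (prim f) (uIcc 0 1) := by
    rw [uIcc_of_le zero_le_one]
    exact continuousOn_prim hf
  have h := integral_mul_add_mul_of_primitive (F := prim f) (f := f) (G := φ)
    (g := deriv φ) (p := 0) (q := 1) hfi
    (hφ.deriv.continuous.intervalIntegrable _ _) (fun x _ => by rw [prim_zero, zero_add]; rfl)
    (fun x _ => hφ.eq_primitive 0 x)
  rw [hφ.zero_of_notMem (by simp), hφ.zero_of_notMem (by simp),
    intervalIntegral.integral_add (hfi.mul_continuousOn hφ.continuous.continuousOn)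
      ((hφ.deriv.continuous.intervalIntegrable _ _).continuousOn_mul hc)] at h
  simp only [intervalIntegral.integral_of_le zero_le_one, integral_Ioc_eq_integral_Ioo] at h
  linarith

/-- A function with an integrable weak derivative and zero boundary values is the primitive of
its weak derivative, which therefore has integral zero. -/
theorem ae_eq_prim {u v : ℝ → ℝ} (hu : LocallyIntegrableOn u (Ioo 0 1))
    (hv : Integrable v unitMeasure) (hu0 : VanishesAtEndpoints u)
    (h : ∀ φ, IsTest φ → ∫ x in Ioo 0 1, u x * deriv φ x = -∫ x in Ioo 0 1, v x * φ x) :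
    u =ᵐ[unitMeasure] prim v ∧ prim v 1 = 0 := by
  have hc := continuousOn_prim hv
  have hpl : LocallyIntegrableOn (prim v) (Ioo 0 1) :=
    (hc.mono Ioo_subset_Icc_self).locallyIntegrableOn measurableSet_Ioo
  obtain ⟨c, hcc⟩ := exists_ae_eq_const (hu.sub hpl) fun φ hφ => by
    simp only [Pi.sub_apply, sub_mul]
    rw [integral_sub (hφ.deriv.integrableOn_mul hu) (hφ.deriv.integrableOn_mul hpl), h φ hφ,
      integral_prim_mul_deriv_test hv hφ, sub_self]
  obtain ⟨g, hg, hg0, hg1, hug⟩ := hu0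
  have heq : EqOn g (fun x => prim v x + c) (Icc 0 1) := by
    refine eqOn_of_ae_eq_unit ?_ hg (hc.add continuousOn_const)
    filter_upwards [hug, hcc] with x h1 h2
    simp only [Pi.sub_apply] at h2
    rw [← h1]
    linarith
  have h0 := heq (show (0 : ℝ) ∈ Icc (0 : ℝ) 1 by simp)
  have h1 := heq (show (1 : ℝ) ∈ Icc (0 : ℝ) 1 by simp)
  simp only [hg0, hg1, prim_zero] at h0 h1
  refine ⟨?_, by linarith⟩
  filter_upwards [hcc] with x h2
  simp only [Pi.sub_apply] at h2
  linarith

/-- Integrals over sets of finite measure are continuous functionals on `L²`. -/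
theorem abs_setIntegral_le {μ : Measure ℝ} (q : Lp ℝ 2 μ) {s : Set ℝ} (hs : MeasurableSet s)
    (hμ : μ s ≠ ⊤) : |∫ x in s, q x ∂μ| ≤ ‖q‖ * Real.sqrt (μ.real s) := by
  rw [← L2.inner_indicatorConstLp_one (𝕜 := ℝ) hs hμ q]
  refine (abs_real_inner_le_norm _ _).trans ?_
  rw [norm_indicatorConstLp (by norm_num) (by norm_num), mul_comm, norm_one, one_mul,
    Real.sqrt_eq_rpow]
  norm_num

/-! ### The degenerate coefficient and the weighted measure -/

/-- The regularity shared by weakly and strongly degenerate coefficients: `a ∈ C¹(0,1]` and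
`x |a'| ≤ 2 a`. -/
structure Coefficient.IsAdmissible (a : Coefficient) : Prop where
  contDiffOn : ContDiffOn ℝ 1 a (Ioc 0 1)
  abs_deriv_le : ∀ x ∈ Ioc (0 : ℝ) 1, x * |a.deriv x| ≤ 2 * a x

theorem Coefficient.IsAdmissible.of_degenerate {a : Coefficient}
    (ha : a.WeaklyDegenerate ∨ a.StronglyDegenerate) : a.IsAdmissible := by
  have key : ∀ K : ℝ, K < 2 → a.IsDegeneracyConstant K →
      ∀ x ∈ Ioc (0 : ℝ) 1, x * |a.deriv x| ≤ 2 * a x := fun K hK h x hx => by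
    have h1 : x * |a.deriv x| / a x ≤ 2 := (h.1 (mem_image_of_mem _ hx)).trans hK.le
    rwa [div_le_iff₀ (a.pos x hx)] at h1
  rcases ha with ⟨h1, K, hK, h2⟩ | ⟨h1, K, hK, h2⟩
  · exact ⟨h1, key K (hK.2.trans one_lt_two) h2⟩
  · exact ⟨h1.mono Ioc_subset_Icc_self, key K hK.2 h2⟩

namespace Coefficient

variable {a : Coefficient}

theorem IsAdmissible.hasDerivAt (h : a.IsAdmissible) {x : ℝ} (hx : x ∈ Ioo (0 : ℝ) 1) :
    HasDerivAt a (a.deriv x) x := by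
  have h1 : DifferentiableAt ℝ a x :=
    (h.contDiffOn.differentiableOn one_ne_zero x ⟨hx.1, hx.2.le⟩).differentiableAt
      (Ioc_mem_nhds hx.1 hx.2)
  have h2 : a.deriv x = _root_.deriv a x := derivWithin_of_mem_nhds (Icc_mem_nhds hx.1 hx.2)
  rw [h2]
  exact h1.hasDerivAt

theorem IsAdmissible.continuousOn_deriv (h : a.IsAdmissible) :
    ContinuousOn a.deriv (Ioo 0 1) := by
  refine ((h.contDiffOn.mono Ioo_subset_Ioc_self).continuousOn_deriv_of_isOpen isOpen_Ioo
    le_rfl).congr fun x hx => ?_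
  exact derivWithin_of_mem_nhds (Icc_mem_nhds hx.1 hx.2)

/-- The bound `x² ≤ a(x) / a(1)`: the quotient `a(x) / x²` is nonincreasing. -/
theorem IsAdmissible.sq_div_le (h : a.IsAdmissible) {x : ℝ} (hx : x ∈ Ioc (0 : ℝ) 1) :
    x ^ 2 / a x ≤ (a 1)⁻¹ := by
  have hc : ContinuousOn (fun x => a x / x ^ 2) (Ioc 0 1) :=
    (a.continuousOn.mono Ioc_subset_Icc_self).div (continuous_pow 2).continuousOn
      fun y hy => pow_ne_zero 2 hy.1.ne'
  have hd : ∀ y ∈ Ioo (0 : ℝ) 1, HasDerivAt (fun x => a x / x ^ 2)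
      ((a.deriv y * y ^ 2 - a y * (2 * y)) / (y ^ 2) ^ 2) y := fun y hy => by
    simpa using (h.hasDerivAt hy).fun_div (hasDerivAt_pow 2 y) (pow_ne_zero 2 hy.1.ne')
  have hanti : AntitoneOn (fun x => a x / x ^ 2) (Ioc 0 1) := by
    refine antitoneOn_of_deriv_nonpos (convex_Ioc 0 1) hc ?_ ?_
    · rw [interior_Ioc]
      exact fun y hy => (hd y hy).differentiableAt.differentiableWithinAt
    · rw [interior_Ioc]
      intro y hy
      rw [(hd y hy).deriv]
      refine div_nonpos_of_nonpos_of_nonneg ?_ (by positivity)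
      have h1 := h.abs_deriv_le y ⟨hy.1, hy.2.le⟩
      have h2 : y * a.deriv y ≤ 2 * a y :=
        (mul_le_mul_of_nonneg_left (le_abs_self _) hy.1.le).trans h1
      nlinarith [hy.1]
  have h1 := hanti hx (right_mem_Ioc.2 one_pos) hx.2
  simp only [one_pow, div_one] at h1
  have ha1 := a.pos 1 (right_mem_Ioc.2 one_pos)
  have hax := a.pos x hx
  have hx2 : 0 < x ^ 2 := pow_pos hx.1 2
  rw [div_le_iff₀ hax, inv_mul_eq_div, le_div_iff₀ ha1]
  rw [le_div_iff₀ hx2] at h1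
  linarith

theorem IsAdmissible.inv_le (h : a.IsAdmissible) {x : ℝ} (hx : x ∈ Ioc (0 : ℝ) 1) :
    1 / a x ≤ (a 1)⁻¹ * (x ^ 2)⁻¹ := by
  have h1 := h.sq_div_le hx
  have hx2 : 0 < x ^ 2 := pow_pos hx.1 2
  rw [← div_eq_mul_inv, le_div_iff₀ hx2]
  rwa [div_mul_eq_mul_div, one_mul]

theorem continuousOn_inv (a : Coefficient) : ContinuousOn (fun x : ℝ => 1 / a x) (Ioc 0 1) :=
  continuousOn_const.div (a.continuousOn.mono Ioc_subset_Icc_self) (fun x hx => (a.pos x hx).ne')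

theorem aemeasurable_density (a : Coefficient) :
    AEMeasurable (fun x => ENNReal.ofReal (1 / a x)) unitMeasure :=
  ((a.continuousOn_inv.mono Ioo_subset_Ioc_self).aemeasurable measurableSet_Ioo).ennreal_ofReal

theorem toReal_density (a : Coefficient) {x : ℝ} (hx : x ∈ Ioo (0 : ℝ) 1) (c : ℝ) :
    (ENNReal.ofReal (1 / a x)).toReal • c = c / a x := by
  rw [ENNReal.toReal_ofReal (one_div_nonneg.2 (a.pos x ⟨hx.1, hx.2.le⟩).le), smul_eq_mul]
  ring

theorem measure_absolutelyContinuous (a : Coefficient) : a.measure ≪ unitMeasure :=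
  withDensity_absolutelyContinuous _ _

theorem setIntegral_measure (a : Coefficient) {s : Set ℝ} (hs : MeasurableSet s)
    (hs' : s ⊆ Ioo 0 1) (g : ℝ → ℝ) : ∫ x in s, g x ∂a.measure = ∫ x in s, g x / a x := by
  have hr : unitMeasure.restrict s = volume.restrict s := by
    rw [Measure.restrict_restrict hs, inter_eq_left.2 hs']
  rw [Coefficient.measure, setIntegral_withDensity_eq_setIntegral_toReal_smul₀
    a.aemeasurable_density.restrict (by simp) g hs, hr]
  exact setIntegral_congr_fun hs fun x hx => a.toReal_density (hs' hx) (g x)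

theorem integral_measure (a : Coefficient) (g : ℝ → ℝ) :
    ∫ x, g x ∂a.measure = ∫ x in Ioo 0 1, g x / a x := by
  rw [Coefficient.measure, integral_withDensity_eq_integral_toReal_smul₀
    a.aemeasurable_density (by simp) g]
  exact setIntegral_congr_fun measurableSet_Ioo fun x hx => a.toReal_density hx (g x)

theorem integrable_measure_iff (a : Coefficient) {g : ℝ → ℝ} :
    Integrable g a.measure ↔ Integrable (fun x => g x / a x) unitMeasure := by
  rw [Coefficient.measure, integrable_withDensity_iff_integrable_smul₀'
    a.aemeasurable_density (by simp)]
  refine integrable_congr ?_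
  exact (ae_restrict_iff' measurableSet_Ioo).2
    (Eventually.of_forall fun x hx => a.toReal_density hx (g x))

theorem integrableOn_measure_iff (a : Coefficient) {s : Set ℝ} (hs : MeasurableSet s)
    (hs' : s ⊆ Ioo 0 1) {g : ℝ → ℝ} :
    IntegrableOn g s a.measure ↔ IntegrableOn (fun x => g x / a x) s := by
  rw [← integrable_indicator_iff hs, integrable_measure_iff, ← integrable_indicator_iff hs]
  have : (fun x => s.indicator g x / a x) = s.indicator (fun x => g x / a x) := by
    ext x
    by_cases hx : x ∈ s <;> simp [hx]
  rw [this, integrable_indicator_iff hs, integrable_indicator_iff hs, IntegrableOn,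
    Measure.restrict_restrict hs, inter_eq_left.2 hs', IntegrableOn]

theorem intervalIntegrable_inv (a : Coefficient) {x : ℝ} (hx : x ∈ Ioc (0 : ℝ) 1) :
    IntervalIntegrable (fun s => 1 / a s) volume x 1 := by
  refine ContinuousOn.intervalIntegrable (a.continuousOn_inv.mono ?_)
  rw [uIcc_of_le hx.2]
  exact fun s hs => ⟨hx.1.trans_le hs.1, hs.2⟩

theorem measure_Ioo_ne_top (a : Coefficient) {x : ℝ} (hx : x ∈ Ioc (0 : ℝ) 1) :
    a.measure (Ioo x 1) ≠ ⊤ := by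
  have h : IntegrableOn (fun _ => (1 : ℝ)) (Ioo x 1) a.measure :=
    (a.integrableOn_measure_iff measurableSet_Ioo (Ioo_subset_Ioo_left hx.1.le)).2
      ((intervalIntegrable_iff_integrableOn_Ioo_of_le hx.2).1 (a.intervalIntegrable_inv hx))
  rw [integrableOn_const_iff] at h
  exact (by simpa using h : a.measure (Ioo x 1) < ⊤).ne

theorem IsAdmissible.measureReal_Ioo_le (h : a.IsAdmissible) {x : ℝ} (hx : x ∈ Ioc (0 : ℝ) 1) :
    a.measure.real (Ioo x 1) ≤ (a 1)⁻¹ * x⁻¹ := by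
  have e1 : a.measure.real (Ioo x 1) = ∫ s in x..1, 1 / a s := by
    have := a.setIntegral_measure measurableSet_Ioo (Ioo_subset_Ioo_left hx.1.le (b := 1))
      (fun _ => 1)
    rw [intervalIntegral.integral_of_le hx.2, integral_Ioc_eq_integral_Ioo, ← this]
    simp
  have h0 : (0 : ℝ) ∉ uIcc x 1 := by
    rw [uIcc_of_le hx.2]
    exact fun h' => absurd h'.1 (not_le.2 hx.1)
  have hi : IntervalIntegrable (fun s : ℝ => (a 1)⁻¹ * (s ^ 2)⁻¹) volume x 1 := by
    refine ContinuousOn.intervalIntegrable (continuousOn_const.mul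
      ((continuous_pow 2).continuousOn.inv₀ fun s hs => ?_))
    exact pow_ne_zero 2 fun h' => h0 (h' ▸ hs)
  have e2 : ∫ s in x..1, (a 1)⁻¹ * (s ^ 2)⁻¹ = (a 1)⁻¹ * (x⁻¹ - 1) := by
    rw [intervalIntegral.integral_const_mul]
    have := integral_zpow (a := x) (b := 1) (n := -2) (Or.inr ⟨by norm_num, h0⟩)
    have e : ∀ s : ℝ, s ^ (-2 : ℤ) = (s ^ 2)⁻¹ := fun s => by
      rw [zpow_neg]
      norm_cast
    simp only [e] at this
    rw [this]
    norm_num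
    left
    ring
  have ha1 : 0 < (a 1)⁻¹ := inv_pos.2 (a.pos 1 (right_mem_Ioc.2 one_pos))
  calc a.measure.real (Ioo x 1) = ∫ s in x..1, 1 / a s := e1
    _ ≤ ∫ s in x..1, (a 1)⁻¹ * (s ^ 2)⁻¹ :=
      intervalIntegral.integral_mono_on hx.2 (a.intervalIntegrable_inv hx) hi
        fun s hs => h.inv_le ⟨hx.1.trans_le hs.1, hs.2⟩
    _ = (a 1)⁻¹ * (x⁻¹ - 1) := e2
    _ ≤ (a 1)⁻¹ * x⁻¹ := mul_le_mul_of_nonneg_left (by linarith) ha1.le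

/-! ### The bending moment as a function of the load -/

/-- The primitive of `w / a` on `(0,1]` that vanishes at `1`. -/
noncomputable def tailPrim (a : Coefficient) (w : ℝ → ℝ) (x : ℝ) : ℝ := -∫ s in x..1, w s / a s

/-- The second primitive of `w / a` on `(0,1]` that vanishes at `1` with its derivative. -/
noncomputable def tailPrimTwo (a : Coefficient) (w : ℝ → ℝ) (x : ℝ) : ℝ :=
  -∫ s in x..1, a.tailPrim w s

theorem intervalIntegrable_div (w : a.L2) {x y : ℝ} (hx : x ∈ Ioc (0 : ℝ) 1)
    (hy : y ∈ Ioc (0 : ℝ) 1) : IntervalIntegrable (fun s => w s / a s) volume x y := by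
  have key : ∀ z ∈ Ioc (0 : ℝ) 1, IntervalIntegrable (fun s => w s / a s) volume z 1 :=
    fun z hz => by
      rw [intervalIntegrable_iff_integrableOn_Ioo_of_le hz.2,
        ← a.integrableOn_measure_iff measurableSet_Ioo (Ioo_subset_Ioo_left hz.1.le)]
      exact integrableOn_Lp_of_measure_ne_top w (by norm_num) (a.measure_Ioo_ne_top hz)
  exact (key x hx).trans (key y hy).symm

theorem tailPrim_add_integral (w : a.L2) {x y : ℝ} (hx : x ∈ Ioc (0 : ℝ) 1)
    (hy : y ∈ Ioc (0 : ℝ) 1) : a.tailPrim w y = a.tailPrim w x + ∫ s in x..y, w s / a s := by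
  have h1 : (1 : ℝ) ∈ Ioc (0 : ℝ) 1 := right_mem_Ioc.2 one_pos
  rw [tailPrim, tailPrim, ← intervalIntegral.integral_add_adjacent_intervals
    (intervalIntegrable_div w hx hy) (intervalIntegrable_div w hy h1)]
  ring

theorem ae_unit_coeFn_sub (w w' : a.L2) :
    (↑(w - w') : ℝ → ℝ) =ᵐ[unitMeasure] fun x => w x - w' x :=
  a.absolutelyContinuous.ae_eq (Lp.coeFn_sub w w')

theorem tailPrim_sub (w w' : a.L2) {x : ℝ} (hx : x ∈ Ioc (0 : ℝ) 1) :
    a.tailPrim ↑(w - w') x = a.tailPrim w x - a.tailPrim w' x := by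
  have h1 : (1 : ℝ) ∈ Ioc (0 : ℝ) 1 := right_mem_Ioc.2 one_pos
  have e : ∫ s in x..1, (w - w' : a.L2) s / a s = ∫ s in x..1, (w s / a s - w' s / a s) := by
    refine intervalIntegral.integral_congr_ae_restrict ?_
    rw [uIoc_of_le hx.2, ← restrict_Ioo_eq_restrict_Ioc]
    filter_upwards [ae_restrict_of_ae_restrict_of_subset (Ioo_subset_Ioo_left hx.1.le)
      (ae_unit_coeFn_sub w w')] with s hs
    rw [hs, sub_div]
  rw [tailPrim, tailPrim, tailPrim, e, intervalIntegral.integral_sub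
    (intervalIntegrable_div w hx h1) (intervalIntegrable_div w' hx h1)]
  ring

/-- Cauchy–Schwarz with `∫ₓ¹ 1/a ≤ C/x`. -/
theorem IsAdmissible.abs_tailPrim_le (h : a.IsAdmissible) (w : a.L2) {x : ℝ}
    (hx : x ∈ Ioc (0 : ℝ) 1) :
    |a.tailPrim w x| ≤ ‖w‖ * Real.sqrt (a 1)⁻¹ * x ^ (-(1 / 2) : ℝ) := by
  rw [tailPrim, abs_neg, intervalIntegral.integral_of_le hx.2, integral_Ioc_eq_integral_Ioo,
    ← a.setIntegral_measure measurableSet_Ioo (Ioo_subset_Ioo_left hx.1.le)]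
  refine (abs_setIntegral_le w measurableSet_Ioo (a.measure_Ioo_ne_top hx)).trans ?_
  rw [mul_assoc]
  refine mul_le_mul_of_nonneg_left ?_ (norm_nonneg _)
  refine (Real.sqrt_le_sqrt (h.measureReal_Ioo_le hx)).trans_eq ?_
  have ha1 : 0 < (a 1)⁻¹ := inv_pos.2 (a.pos 1 (right_mem_Ioc.2 one_pos))
  rw [Real.sqrt_mul ha1.le, Real.rpow_neg hx.1.le, Real.sqrt_inv x, ← Real.sqrt_eq_rpow]

theorem continuousOn_tailPrim (w : a.L2) : ContinuousOn (a.tailPrim w) (Ioc 0 1) := by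
  intro x hx
  have hx2 : x / 2 ∈ Ioc (0 : ℝ) 1 := ⟨by linarith [hx.1], by linarith [hx.1, hx.2]⟩
  have h1 : (1 : ℝ) ∈ Ioc (0 : ℝ) 1 := right_mem_Ioc.2 one_pos
  have hc := intervalIntegral.continuousOn_primitive_interval'
    (intervalIntegrable_div w hx2 h1) left_mem_uIcc
  rw [uIcc_of_le hx2.2] at hc
  have hc' : ContinuousOn (a.tailPrim w) (Icc (x / 2) 1) :=
    (continuousOn_const.add hc).congr fun y hy =>
      tailPrim_add_integral w hx2 ⟨hx2.1.trans_le hy.1, hy.2⟩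
  refine (hc' x ⟨by linarith [hx.1], hx.2⟩).mono_of_mem_nhdsWithin ?_
  filter_upwards [self_mem_nhdsWithin,
    mem_nhdsWithin_of_mem_nhds (Ioi_mem_nhds (show x / 2 < x by linarith [hx.1]))] with y h1 h2
  exact ⟨le_of_lt h2, h1.2⟩

theorem intervalIntegrable_rpow_neg_half (c x y : ℝ) :
    IntervalIntegrable (fun s : ℝ => c * s ^ (-(1 / 2) : ℝ)) volume x y :=
  (intervalIntegral.intervalIntegrable_rpow' (by norm_num)).const_mul c

theorem IsAdmissible.integrable_tailPrim (h : a.IsAdmissible) (w : a.L2) :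
    Integrable (a.tailPrim w) unitMeasure := by
  have hb := (intervalIntegrable_iff_integrableOn_Ioo_of_le zero_le_one).1
    (intervalIntegrable_rpow_neg_half (‖w‖ * Real.sqrt (a 1)⁻¹) 0 1)
  refine Integrable.mono' hb
    (((continuousOn_tailPrim w).mono Ioo_subset_Ioc_self).aestronglyMeasurable measurableSet_Ioo) ?_
  exact (ae_restrict_iff' measurableSet_Ioo).2
    (Eventually.of_forall fun x hx => h.abs_tailPrim_le w ⟨hx.1, hx.2.le⟩)

theorem IsAdmissible.tailPrimTwo_add_integral (h : a.IsAdmissible) (w : a.L2) {x y : ℝ}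
    (hx : x ∈ Icc (0 : ℝ) 1) (hy : y ∈ Icc (0 : ℝ) 1) :
    a.tailPrimTwo w y = a.tailPrimTwo w x + ∫ s in x..y, a.tailPrim w s := by
  have hi := h.integrable_tailPrim w
  rw [tailPrimTwo, tailPrimTwo, ← intervalIntegral.integral_add_adjacent_intervals
    (intervalIntegrable_unit hi hx hy) (intervalIntegrable_unit hi hy (by simp))]
  ring

theorem IsAdmissible.continuousOn_tailPrimTwo (h : a.IsAdmissible) (w : a.L2) :
    ContinuousOn (a.tailPrimTwo w) (Icc 0 1) :=
  (continuousOn_const.add (continuousOn_prim (h.integrable_tailPrim w))).congr fun x hx =>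
    h.tailPrimTwo_add_integral w (by simp) hx

theorem IsAdmissible.tailPrimTwo_sub (h : a.IsAdmissible) (w w' : a.L2) {x : ℝ}
    (hx : x ∈ Icc (0 : ℝ) 1) :
    a.tailPrimTwo ↑(w - w') x = a.tailPrimTwo w x - a.tailPrimTwo w' x := by
  have h1 : (1 : ℝ) ∈ Icc (0 : ℝ) 1 := by simp
  have e : ∫ s in x..1, a.tailPrim ↑(w - w') s
      = ∫ s in x..1, (a.tailPrim w s - a.tailPrim w' s) := by
    refine intervalIntegral.integral_congr_ae (Eventually.of_forall fun s hs => ?_)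
    rw [uIoc_of_le hx.2] at hs
    exact tailPrim_sub w w' ⟨hx.1.trans_lt hs.1, hs.2⟩
  rw [tailPrimTwo, tailPrimTwo, tailPrimTwo, e, intervalIntegral.integral_sub
    (intervalIntegrable_unit (h.integrable_tailPrim w) hx h1)
    (intervalIntegrable_unit (h.integrable_tailPrim w') hx h1)]
  ring

theorem IsAdmissible.abs_tailPrimTwo_le (h : a.IsAdmissible) (w : a.L2) {x : ℝ}
    (hx : x ∈ Icc (0 : ℝ) 1) : |a.tailPrimTwo w x| ≤ 2 * Real.sqrt (a 1)⁻¹ * ‖w‖ := by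
  set c := ‖w‖ * Real.sqrt (a 1)⁻¹
  have hc0 : 0 ≤ c := by positivity
  have e : ∫ s in x..1, c * s ^ (-(1 / 2) : ℝ) = c * (2 * (1 - x ^ (1 / 2 : ℝ))) := by
    rw [intervalIntegral.integral_const_mul, integral_rpow (Or.inl (by norm_num))]
    norm_num
    left
    ring
  rw [tailPrimTwo, abs_neg, ← Real.norm_eq_abs]
  refine (intervalIntegral.norm_integral_le_of_norm_le hx.2 (Eventually.of_forall fun s hs => ?_)
    (intervalIntegrable_rpow_neg_half c x 1)).trans ?_
  · exact h.abs_tailPrim_le w ⟨hx.1.trans_lt hs.1, hs.2⟩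
  · rw [e]
    have : 0 ≤ x ^ (1 / 2 : ℝ) := Real.rpow_nonneg hx.1 _
    nlinarith

end Coefficient

theorem UnitL2.integrable (q : UnitL2) : Integrable q unitMeasure :=
  (Lp.memLp q).integrable (by norm_num)

namespace Coefficient

variable {a : Coefficient}

/-- An element `(u, u', u'')` of `H²_{1/a}` is recovered from `u''` by integrating twice from `0`, and
the boundary conditions at `1` say that `u''` and `u'` have integral zero. -/
theorem H2_ae_eq_prim {p : a.L2 × UnitL2 × UnitL2} (hp : p ∈ a.H2) :
    (p.2.1 =ᵐ[unitMeasure] prim p.2.2 ∧ prim p.2.2 1 = 0) ∧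
      (p.1 =ᵐ[unitMeasure] prim p.2.1 ∧ prim p.2.1 1 = 0) := by
  obtain ⟨h1, h2, h3, h4⟩ := hp
  refine ⟨ae_eq_prim h1.2.1 p.2.2.integrable h4 fun φ hφ => ?_,
    ae_eq_prim h1.1 p.2.1.integrable h3 fun φ hφ => ?_⟩
  · have e1 := h1.2.2 _ hφ.deriv.contDiff hφ.deriv.hasCompactSupport hφ.deriv.tsupport_subset
    have e2 := h2.2.2 _ hφ.contDiff hφ.hasCompactSupport hφ.tsupport_subset
    rw [iteratedDeriv_one] at e1
    rw [iteratedDeriv_succ, iteratedDeriv_one] at e2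
    linarith
  · have e1 := h1.2.2 _ hφ.contDiff hφ.hasCompactSupport hφ.tsupport_subset
    rw [iteratedDeriv_one] at e1
    linarith

/-- The slope of the affine part of the bending moment. -/
noncomputable def bendingSlope (a : Coefficient) (w : ℝ → ℝ) : ℝ :=
  ∫ s in (0 : ℝ)..1, (6 - 12 * s) * a.tailPrimTwo w s

/-- The value at `0` of the affine part of the bending moment. -/
noncomputable def bendingShift (a : Coefficient) (w : ℝ → ℝ) : ℝ :=
  ∫ s in (0 : ℝ)..1, (6 * s - 4) * a.tailPrimTwo w s

/-- The second derivative of the solution of `a u'''' = w` with `u = u' = 0` at `0` and at `1`. The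
affine part is the one for which `∫₀¹ u'' = ∫₀¹ x u'' = 0`, which is what the boundary conditions
amount to. -/
noncomputable def bending (a : Coefficient) (w : ℝ → ℝ) (x : ℝ) : ℝ :=
  a.tailPrimTwo w x + (a.bendingShift w + a.bendingSlope w * x)

/-- The third derivative of the solution of `a u'''' = w` with `u = u' = 0` at `0` and at `1`. -/
noncomputable def shear (a : Coefficient) (w : ℝ → ℝ) (x : ℝ) : ℝ :=
  a.tailPrim w x + a.bendingSlope w

namespace IsAdmissible

theorem intervalIntegrable_mul_tailPrimTwo (h : a.IsAdmissible) (w : a.L2) {f : ℝ → ℝ}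
    (hf : Continuous f) : IntervalIntegrable (fun s => f s * a.tailPrimTwo w s) volume 0 1 := by
  refine ContinuousOn.intervalIntegrable ?_
  rw [uIcc_of_le zero_le_one]
  exact hf.continuousOn.mul (h.continuousOn_tailPrimTwo w)

theorem abs_integral_mul_tailPrimTwo_le (h : a.IsAdmissible) (w : a.L2) {f : ℝ → ℝ} {M : ℝ}
    (hM : ∀ x ∈ Icc (0 : ℝ) 1, |f x| ≤ M) :
    |∫ s in (0 : ℝ)..1, f s * a.tailPrimTwo w s| ≤ M * (2 * Real.sqrt (a 1)⁻¹ * ‖w‖) := by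
  have := intervalIntegral.norm_integral_le_of_norm_le_const (a := 0) (b := 1)
    (f := fun s => f s * a.tailPrimTwo w s) (C := M * (2 * Real.sqrt (a 1)⁻¹ * ‖w‖))
    fun s hs => by
      rw [uIoc_of_le zero_le_one] at hs
      have hs' : s ∈ Icc (0 : ℝ) 1 := ⟨hs.1.le, hs.2⟩
      rw [norm_mul]
      exact mul_le_mul (hM s hs') (h.abs_tailPrimTwo_le w hs') (norm_nonneg _)
        ((abs_nonneg _).trans (hM s hs'))
  simpa using this

theorem integral_mul_tailPrimTwo_sub (h : a.IsAdmissible) (w w' : a.L2) {f : ℝ → ℝ}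
    (hf : Continuous f) : ∫ s in (0 : ℝ)..1, f s * a.tailPrimTwo ↑(w - w') s
      = (∫ s in (0 : ℝ)..1, f s * a.tailPrimTwo w s)
        - ∫ s in (0 : ℝ)..1, f s * a.tailPrimTwo w' s := by
  rw [← intervalIntegral.integral_sub (h.intervalIntegrable_mul_tailPrimTwo w hf)
    (h.intervalIntegrable_mul_tailPrimTwo w' hf)]
  refine intervalIntegral.integral_congr fun s hs => ?_
  rw [uIcc_of_le zero_le_one] at hs
  simp only [h.tailPrimTwo_sub w w' hs]
  ring

theorem continuousOn_bending (h : a.IsAdmissible) (w : a.L2) :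
    ContinuousOn (a.bending w) (Icc 0 1) :=
  (h.continuousOn_tailPrimTwo w).add
    (continuous_const.add (continuous_const.mul continuous_id)).continuousOn

theorem integrable_bending (h : a.IsAdmissible) (w : a.L2) :
    Integrable (a.bending w) unitMeasure :=
  (h.continuousOn_bending w).integrableOn_Icc.mono_set Ioo_subset_Icc_self

theorem abs_bending_le (h : a.IsAdmissible) (w : a.L2) {x : ℝ} (hx : x ∈ Icc (0 : ℝ) 1) :
    |a.bending w x| ≤ 22 * Real.sqrt (a 1)⁻¹ * ‖w‖ := by
  have h1 := h.abs_tailPrimTwo_le w hx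
  have h2 : |a.bendingShift w| ≤ _ := h.abs_integral_mul_tailPrimTwo_le w
    (f := fun s => 6 * s - 4) (M := 4)
    fun s hs => abs_le.2 ⟨by linarith [hs.1], by linarith [hs.2]⟩
  have h3 : |a.bendingSlope w| ≤ _ := h.abs_integral_mul_tailPrimTwo_le w
    (f := fun s => 6 - 12 * s) (M := 6)
    fun s hs => abs_le.2 ⟨by linarith [hs.2], by linarith [hs.1]⟩
  have h4 : |a.bendingSlope w * x| ≤ |a.bendingSlope w| := by
    rw [abs_mul, abs_of_nonneg hx.1]
    exact mul_le_of_le_one_right (abs_nonneg _) hx.2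
  have h5 := abs_add_le (a.tailPrimTwo w x) (a.bendingShift w + a.bendingSlope w * x)
  have h6 := abs_add_le (a.bendingShift w) (a.bendingSlope w * x)
  rw [bending]
  linarith

theorem bending_sub (h : a.IsAdmissible) (w w' : a.L2) {x : ℝ} (hx : x ∈ Icc (0 : ℝ) 1) :
    a.bending ↑(w - w') x = a.bending w x - a.bending w' x := by
  have h1 := h.integral_mul_tailPrimTwo_sub w w' (f := fun s => 6 * s - 4) (by fun_prop)
  have h2 := h.integral_mul_tailPrimTwo_sub w w' (f := fun s => 6 - 12 * s) (by fun_prop)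
  rw [bending, bending, bending, bendingShift, bendingSlope, h1, h2, h.tailPrimTwo_sub w w' hx,
    bendingShift, bendingSlope, bendingShift, bendingSlope]
  ring

theorem abs_bending_sub_le (h : a.IsAdmissible) (w w' : a.L2) {x : ℝ} (hx : x ∈ Icc (0 : ℝ) 1) :
    |a.bending w x - a.bending w' x| ≤ 22 * Real.sqrt (a 1)⁻¹ * ‖w - w'‖ := by
  rw [← h.bending_sub w w' hx]
  exact h.abs_bending_le _ hx

theorem hasDerivAt_bending (h : a.IsAdmissible) (w : a.L2) {x : ℝ} (hx : x ∈ Ioo (0 : ℝ) 1) :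
    HasDerivAt (a.bending w) (a.shear w x) x := by
  have hcont : ContinuousAt (a.tailPrim w) x :=
    (continuousOn_tailPrim w).continuousAt (Ioc_mem_nhds hx.1 hx.2)
  have h1 : HasDerivAt (fun y => ∫ s in y..1, a.tailPrim w s) (-a.tailPrim w x) x := by
    refine intervalIntegral.integral_hasDerivAt_left
      (intervalIntegrable_unit (h.integrable_tailPrim w) (Ioo_subset_Icc_self hx) (by simp)) ?_
      hcont
    exact ((continuousOn_tailPrim w).mono Ioo_subset_Ioc_self).stronglyMeasurableAtFilter
      isOpen_Ioo x hx
  have h2 := h1.fun_neg.add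
    (((hasDerivAt_id x).const_mul (a.bendingSlope w)).const_add (a.bendingShift w))
  rw [neg_neg, mul_one] at h2
  exact h2

/-- The second weak derivative of the second primitive of `w / a` is `w / a`. -/
theorem integral_tailPrimTwo_mul_deriv_deriv (h : a.IsAdmissible) (w : a.L2) {φ : ℝ → ℝ}
    (hφ : IsTest φ) : ∫ x in Ioo 0 1, a.tailPrimTwo w x * _root_.deriv (_root_.deriv φ) x
      = ∫ x in Ioo 0 1, w x / a x * φ x := by
  obtain ⟨p, q, hp, hpq, hq, hz⟩ := hφ.exists_zero_outside
  have hp1 : p ∈ Ioc (0 : ℝ) 1 := ⟨hp, (hpq.trans hq).le⟩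
  have h11 : (1 : ℝ) ∈ Ioc (0 : ℝ) 1 := right_mem_Ioc.2 one_pos
  have hz' : ∀ x ∈ Iio p, φ x = 0 := fun x hx => hz x fun h' => absurd h'.1 (not_le.2 hx)
  have hzd : ∀ x ∈ Iio p, _root_.deriv φ x = 0 := fun x hx => by
    have : φ =ᶠ[𝓝 x] fun _ => 0 := by
      filter_upwards [Iio_mem_nhds hx] with y hy using hz' y hy
    rw [this.deriv_eq, deriv_const]
  have hp0 : φ p = 0 := by
    have : p ∈ closure (Iio p) := by simp
    exact closure_minimal (s := Iio p) (t := {x | φ x = 0}) hz'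
      (isClosed_eq hφ.continuous continuous_const) this
  -- first integration by parts, on all of `(0,1)`
  have hT := h.integrable_tailPrim w
  have e1 := integral_mul_add_mul_of_primitive (F := a.tailPrimTwo w) (f := a.tailPrim w)
    (G := _root_.deriv φ) (g := _root_.deriv (_root_.deriv φ)) (p := 0) (q := 1)
    (intervalIntegrable_unit hT (by simp) (by simp))
    (hφ.deriv.deriv.continuous.intervalIntegrable _ _)
    (fun x hx => h.tailPrimTwo_add_integral w (by simp) (by rwa [uIcc_of_le zero_le_one] at hx))
    (fun x _ => hφ.deriv.eq_primitive 0 x)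
  have hc : ContinuousOn (a.tailPrimTwo w) (uIcc 0 1) := by
    rw [uIcc_of_le zero_le_one]
    exact h.continuousOn_tailPrimTwo w
  rw [hφ.deriv.zero_of_notMem (by simp), hφ.deriv.zero_of_notMem (by simp),
    intervalIntegral.integral_add
      ((intervalIntegrable_unit hT (by simp) (by simp)).mul_continuousOn
        hφ.deriv.continuous.continuousOn)
      ((hφ.deriv.deriv.continuous.intervalIntegrable _ _).continuousOn_mul hc)] at e1
  -- second integration by parts, on `(p,1)`, since `w / a` need not be integrable near `0`
  have e2 := integral_mul_add_mul_of_primitive (F := a.tailPrim w) (f := fun s => w s / a s)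
    (G := φ) (g := _root_.deriv φ) (p := p) (q := 1) (intervalIntegrable_div w hp1 h11)
    (hφ.deriv.continuous.intervalIntegrable _ _)
    (fun x hx => tailPrim_add_integral w hp1 (by
      rw [uIcc_of_le hp1.2] at hx
      exact ⟨hp.trans_le hx.1, hx.2⟩))
    (fun x _ => hφ.eq_primitive p x)
  have hc2 : ContinuousOn (a.tailPrim w) (uIcc p 1) := by
    rw [uIcc_of_le hp1.2]
    exact (continuousOn_tailPrim w).mono fun x hx => ⟨hp.trans_le hx.1, hx.2⟩
  rw [hp0, hφ.zero_of_notMem (by simp), intervalIntegral.integral_add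
      ((intervalIntegrable_div w hp1 h11).mul_continuousOn hφ.continuous.continuousOn)
      ((hφ.deriv.continuous.intervalIntegrable _ _).continuousOn_mul hc2)] at e2
  have e3 : ∀ {k ψ : ℝ → ℝ}, (∀ x ∈ Iio p, ψ x = 0) →
      ∫ x in Ioo 0 1, k x * ψ x = ∫ x in p..1, k x * ψ x := fun {k ψ} hψ => by
    rw [intervalIntegral.integral_of_le hp1.2, ← integral_Icc_eq_integral_Ioc,
      ← integral_Icc_eq_integral_Ioo]
    refine setIntegral_eq_of_subset_of_forall_sdiff_eq_zero measurableSet_Icc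
      (Icc_subset_Icc_left hp.le) fun x hx => ?_
    rw [hψ x, mul_zero]
    exact not_le.1 fun h' => hx.2 ⟨h', hx.1.2⟩
  rw [e3 hz']
  have e4 := e3 (k := a.tailPrim w) hzd
  simp only [intervalIntegral.integral_of_le zero_le_one, integral_Ioc_eq_integral_Ioo] at e1
  linarith

/-- The representation of `u''` for `u ∈ D(A)` through the load `A u`. -/
theorem ae_eq_bending (h : a.IsAdmissible) (p : a.D) :
    p.1.1.1.2.2 =ᵐ[unitMeasure] a.bending p.1.2 := by
  set w := p.1.2
  set u₂ := p.1.1.1.2.2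
  obtain ⟨-, hw2, -, -⟩ := p.1.1.2
  have hw4 : HasWeakDeriv 4 p.1.1.1.1 (fun x => w x / a x) := p.2
  obtain ⟨⟨hu1, hu1'⟩, ⟨-, hu0'⟩⟩ := H2_ae_eq_prim p.1.1.2
  have hi2 := u₂.integrable
  have hil : LocallyIntegrableOn u₂ (Ioo 0 1) := hw2.2.1
  have hH : LocallyIntegrableOn (a.tailPrimTwo w) (Ioo 0 1) :=
    ((h.continuousOn_tailPrimTwo w).mono Ioo_subset_Icc_self).locallyIntegrableOn measurableSet_Ioo
  obtain ⟨α, β, hαβ⟩ := exists_ae_eq_affine (hil.sub hH) fun φ hφ => by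
    have e1 := hw2.2.2 _ hφ.deriv.deriv.contDiff hφ.deriv.deriv.hasCompactSupport
      hφ.deriv.deriv.tsupport_subset
    have e2 := hw4.2.2 _ hφ.contDiff hφ.hasCompactSupport hφ.tsupport_subset
    have e3 : iteratedDeriv 4 φ = iteratedDeriv 2 (_root_.deriv (_root_.deriv φ)) := by
      simp only [iteratedDeriv_succ', iteratedDeriv_zero]
    rw [e3] at e2
    have e4 := h.integral_tailPrimTwo_mul_deriv_deriv w hφ
    simp only [Pi.sub_apply, sub_mul]
    rw [integral_sub (hφ.deriv.deriv.integrableOn_mul hil) (hφ.deriv.deriv.integrableOn_mul hH)]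
    linarith
  have hae : u₂ =ᵐ[unitMeasure] fun x => a.tailPrimTwo w x + (α + β * x) :=
    hαβ.mono fun x hx => by simp only [Pi.sub_apply] at hx; linarith
  have hT := h.intervalIntegrable_mul_tailPrimTwo w (f := fun _ => 1) continuous_const
  have hT' := h.intervalIntegrable_mul_tailPrimTwo w (f := fun s => s) continuous_id
  -- the zeroth moment of `u''` vanishes because `u'` vanishes at both ends
  have m0 : (∫ s in (0 : ℝ)..1, 1 * a.tailPrimTwo w s) + (α + β / 2) = 0 := by
    have e : ∫ x in (0 : ℝ)..1, (α + β * x) = α + β / 2 := by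
      rw [intervalIntegral.integral_add (by simp)
        ((by fun_prop : Continuous fun x : ℝ => β * x).intervalIntegrable _ _),
        intervalIntegral.integral_const_mul, integral_id]
      norm_num
      ring
    refine Eq.trans ?_ hu1'
    rw [prim_congr hae (by simp), prim, ← e, ← intervalIntegral.integral_add hT
      ((by fun_prop : Continuous fun x : ℝ => α + β * x).intervalIntegrable _ _)]
    simp only [one_mul]
  -- the first moment vanishes because moreover `u` vanishes at both ends
  have m1 : (∫ s in (0 : ℝ)..1, s * a.tailPrimTwo w s) + (α / 2 + β / 3) = 0 := by
    have hi := intervalIntegrable_unit hi2 (x := 0) (y := 1) (by simp) (by simp)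
    have hcp : ContinuousOn (prim u₂) (uIcc 0 1) := by
      rw [uIcc_of_le zero_le_one]
      exact continuousOn_prim hi2
    have e := integral_mul_add_mul_of_primitive (F := prim u₂) (f := u₂) (G := fun x => x)
      (g := fun _ => 1) (p := 0) (q := 1) hi (by simp)
      (fun x _ => by rw [prim_zero, zero_add]; rfl) (fun x _ => by simp)
    have hix : IntervalIntegrable (fun x => u₂ x * x) volume 0 1 :=
      hi.mul_continuousOn continuousOn_id
    rw [intervalIntegral.integral_add hix (by simpa using hcp.intervalIntegrable), hu1',
      mul_zero, zero_mul, sub_zero] at e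
    have e2 : ∫ x in (0 : ℝ)..1, prim u₂ x * 1 = 0 := by
      simp only [mul_one]
      exact (prim_congr hu1 (x := 1) (by simp)).symm.trans hu0'
    have e3 : ∫ x in (0 : ℝ)..1, u₂ x * x
        = ∫ x in (0 : ℝ)..1, (x * a.tailPrimTwo w x + (α * x + β * x ^ 2)) := by
      refine intervalIntegral.integral_congr_ae_restrict ?_
      rw [uIoc_of_le zero_le_one, ← restrict_Ioo_eq_restrict_Ioc]
      filter_upwards [hae] with x hx
      rw [hx]
      ring
    rw [e2, add_zero, e3, intervalIntegral.integral_add hT'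
      ((by fun_prop : Continuous fun x : ℝ => α * x + β * x ^ 2).intervalIntegrable _ _),
      intervalIntegral.integral_add
        ((by fun_prop : Continuous fun x : ℝ => α * x).intervalIntegrable _ _)
        ((by fun_prop : Continuous fun x : ℝ => β * x ^ 2).intervalIntegrable _ _),
      intervalIntegral.integral_const_mul, intervalIntegral.integral_const_mul, integral_id,
      integral_pow] at e
    norm_num at e
    linarith
  have hβ : a.bendingSlope w = β := by
    have : a.bendingSlope w = 6 * (∫ s in (0 : ℝ)..1, 1 * a.tailPrimTwo w s)
        - 12 * ∫ s in (0 : ℝ)..1, s * a.tailPrimTwo w s := by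
      rw [bendingSlope, ← intervalIntegral.integral_const_mul,
        ← intervalIntegral.integral_const_mul,
        ← intervalIntegral.integral_sub (hT.const_mul 6) (hT'.const_mul 12)]
      exact intervalIntegral.integral_congr fun s _ => by ring
    linarith
  have hα : a.bendingShift w = α := by
    have : a.bendingShift w = 6 * (∫ s in (0 : ℝ)..1, s * a.tailPrimTwo w s)
        - 4 * ∫ s in (0 : ℝ)..1, 1 * a.tailPrimTwo w s := by
      rw [bendingShift, ← intervalIntegral.integral_const_mul,
        ← intervalIntegral.integral_const_mul,
        ← intervalIntegral.integral_sub (hT'.const_mul 6) (hT.const_mul 4)]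
      exact intervalIntegral.integral_congr fun s _ => by ring
    linarith
  filter_upwards [hae] with x hx
  rw [hx, bending, hα, hβ]

end IsAdmissible

end Coefficient

/-! ### Integral identities in the space variable -/

theorem integrableOn_of_continuousOn_of_abs_le {X : Type*} [TopologicalSpace X] [MeasurableSpace X]
    [OpensMeasurableSpace X] [SecondCountableTopology X] {μ : Measure X} {s : Set X}
    (hs : MeasurableSet s) (hμ : μ s ≠ ⊤) {f : X → ℝ} (hf : ContinuousOn f s) {M : ℝ}
    (hM : ∀ x ∈ s, |f x| ≤ M) : IntegrableOn f s μ :=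
  ⟨hf.aestronglyMeasurable hs, .restrict_of_bounded M hμ.lt_top
    ((ae_restrict_iff' hs).2 (Eventually.of_forall hM))⟩

theorem hasDerivAt_prim {f : ℝ → ℝ} (hf : ContinuousOn f (Icc 0 1)) {x : ℝ}
    (hx : x ∈ Ioo (0 : ℝ) 1) : HasDerivAt (prim f) (f x) x := by
  refine intervalIntegral.integral_hasDerivAt_right (intervalIntegrable_unit
    (hf.integrableOn_Icc.mono_set Ioo_subset_Icc_self) (by simp) (Ioo_subset_Icc_self hx)) ?_
    (hf.continuousAt (Icc_mem_nhds hx.1 hx.2))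
  exact (hf.mono Ioo_subset_Icc_self).stronglyMeasurableAtFilter isOpen_Ioo x hx

theorem abs_prim_le {f : ℝ → ℝ} {M : ℝ} (hM : ∀ x ∈ Icc (0 : ℝ) 1, |f x| ≤ M) {x : ℝ}
    (hx : x ∈ Icc (0 : ℝ) 1) : |prim f x| ≤ M * x := by
  have := intervalIntegral.norm_integral_le_of_norm_le_const (a := 0) (b := x) (f := f) (C := M)
    fun s hs => by
      rw [uIoc_of_le hx.1] at hs
      exact hM s ⟨hs.1.le, hs.2.trans hx.2⟩
  rwa [sub_zero, abs_of_nonneg hx.1] at this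

theorem tendsto_integral_left {k : ℝ → ℝ} (hk : IntegrableOn k (Ioo 0 1)) :
    Tendsto (fun ε => ∫ x in ε..1, k x) (𝓝[>] 0) (𝓝 (∫ x in Ioo 0 1, k x)) := by
  have hk' : IntegrableOn k (uIcc 0 1) := by
    rwa [uIcc_of_le zero_le_one, integrableOn_Icc_iff_integrableOn_Ioo]
  have h := intervalIntegral.continuousOn_primitive_interval_left hk' 0 left_mem_uIcc
  rw [ContinuousWithinAt, uIcc_of_le zero_le_one,
    intervalIntegral.integral_of_le zero_le_one, integral_Ioc_eq_integral_Ioo] at h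
  refine h.mono_left ?_
  rw [← nhdsWithin_Ioo_eq_nhdsGT one_pos]
  exact nhdsWithin_mono _ Ioo_subset_Icc_self

namespace Coefficient.IsAdmissible

variable {a : Coefficient}

theorem abs_shear_le (h : a.IsAdmissible) (w : a.L2) {x : ℝ} (hx : x ∈ Ioc (0 : ℝ) 1) :
    |a.shear w x| ≤ ‖w‖ * Real.sqrt (a 1)⁻¹ * x ^ (-(1 / 2) : ℝ) + |a.bendingSlope w| :=
  (abs_add_le _ _).trans (add_le_add_left (h.abs_tailPrim_le w hx) _)

theorem tendsto_sq_mul_shear (h : a.IsAdmissible) (w : a.L2) :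
    Tendsto (fun x => x ^ 2 * a.shear w x) (𝓝[>] 0) (𝓝 0) := by
  have h1 : Tendsto (fun x : ℝ => ‖w‖ * Real.sqrt (a 1)⁻¹ * x ^ (3 / 2 : ℝ)
      + |a.bendingSlope w| * x ^ 2) (𝓝[>] 0) (𝓝 0) := by
    have : Continuous fun x : ℝ => ‖w‖ * Real.sqrt (a 1)⁻¹ * x ^ (3 / 2 : ℝ)
        + |a.bendingSlope w| * x ^ 2 :=
      (continuous_const.mul (Real.continuous_rpow_const (by norm_num))).add
        (continuous_const.mul (continuous_pow 2))
    have h2 := this.tendsto 0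
    simp only [ne_eq, OfNat.ofNat_ne_zero, not_false_eq_true, zero_pow, mul_zero, add_zero] at h2
    rw [Real.zero_rpow (by norm_num), mul_zero] at h2
    exact h2.mono_left nhdsWithin_le_nhds
  refine squeeze_zero_norm' ?_ h1
  filter_upwards [Ioo_mem_nhdsGT one_pos] with x hx
  have h3 := mul_le_mul_of_nonneg_left (h.abs_shear_le w ⟨hx.1, hx.2.le⟩) (sq_nonneg x)
  have h4 : x ^ 2 * x ^ (-(1 / 2) : ℝ) = x ^ (3 / 2 : ℝ) := by
    rw [← Real.rpow_natCast, ← Real.rpow_add hx.1]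
    norm_num
  rw [Real.norm_eq_abs, abs_mul, abs_of_nonneg (sq_nonneg x)]
  refine h3.trans_eq ?_
  rw [← h4]
  ring

/-- The multiplier identity in space: `∫ x² u' u'''' = 3 ∫ x u''² - u''(1)² / 2`. The boundary
terms at `0` vanish because `u''` is bounded and `u''' = O(x^(-1/2))`. -/
theorem integral_load_mul (h : a.IsAdmissible) (w : a.L2) (hw : prim (a.bending w) 1 = 0)
    (hi : IntegrableOn (fun x => w x / a x * (x ^ 2 * prim (a.bending w) x)) (Ioo 0 1)) :
    ∫ x in Ioo 0 1, w x / a x * (x ^ 2 * prim (a.bending w) x)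
      = 3 * (∫ x in Ioo 0 1, x * a.bending w x ^ 2) - a.bending w 1 ^ 2 / 2 := by
  set B := a.bending w
  set U := prim B
  set S := a.shear w with hS
  have cB : ContinuousOn B (Icc 0 1) := h.continuousOn_bending w
  have cU : ContinuousOn U (Icc 0 1) := continuousOn_prim (h.integrable_bending w)
  have cS : ContinuousOn S (Ioc 0 1) := (continuousOn_tailPrim w).add continuousOn_const
  have dB : ∀ x ∈ Ioo (0 : ℝ) 1, HasDerivAt B (S x) x := fun x hx => h.hasDerivAt_bending w hx
  have dU : ∀ x ∈ Ioo (0 : ℝ) 1, HasDerivAt U (B x) x := fun x hx => hasDerivAt_prim cB hx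
  have hBi : IntegrableOn (fun x => x * B x ^ 2) (Ioo 0 1) :=
    (continuousOn_id.mul (cB.pow 2)).integrableOn_Icc.mono_set Ioo_subset_Icc_self
  set Ψ : ℝ → ℝ := fun x => x ^ 2 * B x ^ 2 / 2 + 2 * x * U x * B x - U x ^ 2 with hΨ
  have cΨ : ContinuousOn Ψ (Icc 0 1) := by fun_prop
  have cx : ContinuousOn (fun x : ℝ => x) (Icc 0 1) := continuousOn_id
  -- `Ψ' = 3 x u''² + (x² u')' u'''`, and `(x² u')' u'''` is what is left of `x² u' u''''` after one
  -- integration by parts, up to sign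
  have key : ∀ ε ∈ Ioo (0 : ℝ) 1, (∫ x in ε..1, (w x / a x * (x ^ 2 * U x) - 3 * (x * B x ^ 2)))
      = -(ε ^ 2 * S ε * U ε) - B 1 ^ 2 / 2 + Ψ ε := by
    intro ε hε
    have hε' : ε ∈ Ioc (0 : ℝ) 1 := ⟨hε.1, hε.2.le⟩
    have h1 : (1 : ℝ) ∈ Ioc (0 : ℝ) 1 := right_mem_Ioc.2 one_pos
    have sub1 : ∀ {x}, x ∈ Icc ε 1 → Icc ε x ⊆ Icc 0 1 := fun hx =>
      Icc_subset_Icc hε.1.le hx.2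
    have sub2 : Icc ε 1 ⊆ Ioc 0 1 := fun x hx => ⟨hε.1.trans_le hx.1, hx.2⟩
    have cg : ContinuousOn (fun x => 2 * x * U x + x ^ 2 * B x) (Icc 0 1) := by fun_prop
    have ig : ∀ x ∈ Icc ε 1, IntervalIntegrable (fun x => 2 * x * U x + x ^ 2 * B x)
        volume ε x := fun x hx => by
      refine ContinuousOn.intervalIntegrable (cg.mono ?_)
      rw [uIcc_of_le hx.1]
      exact sub1 hx
    have hG : ∀ x ∈ uIcc ε 1, x ^ 2 * U x
        = ε ^ 2 * U ε + ∫ s in ε..x, (2 * s * U s + s ^ 2 * B s) := fun x hx => by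
      rw [uIcc_of_le hε.2.le] at hx
      rw [intervalIntegral.integral_eq_sub_of_hasDerivAt_of_le (f := fun x => x ^ 2 * U x) hx.1
        (((continuousOn_pow 2).mul cU).mono (sub1 hx)) (fun s hs => ?_) (ig x hx)]
      · ring
      · simpa using (hasDerivAt_pow 2 s).fun_mul (dU s ⟨hε.1.trans hs.1, hs.2.trans_le hx.2⟩)
    have e1 := integral_mul_add_mul_of_primitive (F := S) (f := fun s => w s / a s)
      (G := fun x => x ^ 2 * U x) (g := fun x => 2 * x * U x + x ^ 2 * B x)
      (intervalIntegrable_div w hε' h1) (ig 1 (right_mem_Icc.2 hε.2.le))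
      (fun x hx => by
        rw [uIcc_of_le hε.2.le] at hx
        rw [hS, shear, shear, tailPrim_add_integral w hε' (sub2 hx)]
        ring) hG
    have cSg : ContinuousOn (fun x => S x * (2 * x * U x + x ^ 2 * B x)) (uIcc ε 1) := by
      rw [uIcc_of_le hε.2.le]
      exact (cS.mono sub2).mul (cg.mono (sub1 (right_mem_Icc.2 hε.2.le)))
    have cBB : ContinuousOn (fun x => 3 * (x * B x ^ 2)) (uIcc ε 1) := by
      rw [uIcc_of_le hε.2.le]
      exact (continuousOn_const.mul (cx.mul (cB.pow 2))).mono (sub1 (right_mem_Icc.2 hε.2.le))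
    have cG : ContinuousOn (fun x => x ^ 2 * U x) (uIcc ε 1) := by
      rw [uIcc_of_le hε.2.le]
      exact ((continuousOn_pow 2).mul cU).mono (sub1 (right_mem_Icc.2 hε.2.le))
    have iG := (intervalIntegrable_div w hε' h1).mul_continuousOn cG
    have e2 : ∫ x in ε..1, (3 * (x * B x ^ 2) + S x * (2 * x * U x + x ^ 2 * B x))
        = Ψ 1 - Ψ ε := by
      refine intervalIntegral.integral_eq_sub_of_hasDerivAt_of_le hε.2.le
        (cΨ.mono (sub1 (right_mem_Icc.2 hε.2.le))) (fun s hs => ?_)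
        (cBB.intervalIntegrable.add cSg.intervalIntegrable)
      have hs' : s ∈ Ioo (0 : ℝ) 1 := ⟨hε.1.trans hs.1, hs.2⟩
      have d := ((((hasDerivAt_pow 2 s).fun_mul ((dB s hs').fun_pow 2)).div_const 2).fun_add
        ((((hasDerivAt_id' s).const_mul 2).fun_mul (dU s hs')).fun_mul (dB s hs'))).fun_sub
        ((dU s hs').fun_pow 2)
      refine d.congr_deriv ?_
      simp only [Nat.cast_ofNat, Nat.add_one_sub_one, pow_one]
      ring
    rw [intervalIntegral.integral_add iG cSg.intervalIntegrable] at e1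
    rw [intervalIntegral.integral_add cBB.intervalIntegrable cSg.intervalIntegrable] at e2
    rw [intervalIntegral.integral_sub iG cBB.intervalIntegrable]
    have e3 : Ψ 1 = B 1 ^ 2 / 2 := by
      simp only [hΨ, hw]
      ring
    rw [hw] at e1
    rw [e3] at e2
    linarith
  have lim1 := tendsto_integral_left (hi.sub (hBi.const_mul 3))
  have lim2 : Tendsto (fun ε => -(ε ^ 2 * S ε * U ε) - B 1 ^ 2 / 2 + Ψ ε) (𝓝[>] 0)
      (𝓝 (-(0 * 0) - B 1 ^ 2 / 2 + 0)) := by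
    have hle : 𝓝[>] (0 : ℝ) ≤ 𝓝[Icc 0 1] 0 := by
      rw [← nhdsWithin_Ioo_eq_nhdsGT one_pos]
      exact nhdsWithin_mono _ Ioo_subset_Icc_self
    have tU := (cU 0 (by simp)).mono_left hle
    have tΨ := (cΨ 0 (by simp)).mono_left hle
    have hU0 : U 0 = 0 := prim_zero B
    have hΨ0 : Ψ 0 = 0 := by simp [hΨ, hU0]
    rw [hU0] at tU
    rw [hΨ0] at tΨ
    exact (((h.tendsto_sq_mul_shear w).mul tU).neg.sub_const _).add tΨ
  have heq := tendsto_nhds_unique (lim1.congr' ?_) lim2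
  · simp only [Pi.sub_apply] at heq
    rw [integral_sub hi (hBi.const_mul 3), integral_const_mul] at heq
    linarith
  · filter_upwards [Ioo_mem_nhdsGT one_pos] with ε hε using key ε hε

theorem continuousOn_sq_div (a : Coefficient) : ContinuousOn (fun x : ℝ => x ^ 2 / a x) (Ioc 0 1) :=
  (continuousOn_pow 2).div (a.continuousOn.mono Ioc_subset_Icc_self) fun x hx => (a.pos x hx).ne'

/-- The weight `(x / a) (2 - x a' / a)` is dominated by `4 x / a`, hence `O(1 / x)`. -/
theorem abs_weight_le (h : a.IsAdmissible) {x M v : ℝ} (hx : x ∈ Ioo (0 : ℝ) 1)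
    (hv : |v| ≤ M * x) :
    |x / a x * v ^ 2 * (2 - x * a.deriv x / a x)| ≤ 4 * (a 1)⁻¹ * M ^ 2 := by
  have hx' : x ∈ Ioc (0 : ℝ) 1 := ⟨hx.1, hx.2.le⟩
  have hax := a.pos x hx'
  have ha1 : 0 < (a 1)⁻¹ := inv_pos.2 (a.pos 1 (right_mem_Ioc.2 one_pos))
  have h1 : |2 - x * a.deriv x / a x| ≤ 4 := by
    have : |x * a.deriv x / a x| ≤ 2 := by
      rw [abs_div, abs_mul, abs_of_pos hx.1, abs_of_pos hax, div_le_iff₀ hax]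
      exact h.abs_deriv_le x hx'
    rw [abs_le] at this ⊢
    constructor <;> linarith [this.1, this.2]
  have h2 : v ^ 2 ≤ (M * x) ^ 2 := sq_le_sq' (by linarith [(abs_le.1 hv).1]) (abs_le.1 hv).2
  have h3 : x / a x * v ^ 2 ≤ (a 1)⁻¹ * M ^ 2 := by
    calc x / a x * v ^ 2 ≤ x / a x * (M * x) ^ 2 :=
          mul_le_mul_of_nonneg_left h2 (div_pos hx.1 hax).le
      _ = x ^ 2 / a x * (M ^ 2 * x) := by ring
      _ ≤ (a 1)⁻¹ * (M ^ 2 * 1) := mul_le_mul (h.sq_div_le hx')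
          (mul_le_mul_of_nonneg_left hx.2.le (sq_nonneg M))
          (mul_nonneg (sq_nonneg M) hx.1.le) ha1.le
      _ = (a 1)⁻¹ * M ^ 2 := by ring
  have h4 : 0 ≤ x / a x * v ^ 2 := mul_nonneg (div_pos hx.1 hax).le (sq_nonneg v)
  rw [abs_mul, abs_of_nonneg h4]
  calc x / a x * v ^ 2 * |2 - x * a.deriv x / a x| ≤ ((a 1)⁻¹ * M ^ 2) * 4 :=
        mul_le_mul h3 h1 (abs_nonneg _) (h4.trans h3)
    _ = 4 * (a 1)⁻¹ * M ^ 2 := by ring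

/-- Integration by parts for `v v' = (v²)' / 2` against the weight `x² / a`. -/
theorem integral_mul_sq_div_mul_deriv (h : a.IsAdmissible) {f : ℝ → ℝ}
    (hf : ContinuousOn f (Icc 0 1)) (h1 : prim f 1 = 0) :
    ∫ x in Ioo 0 1, prim f x * (x ^ 2 / a x) * f x
      = -(1 / 2) * ∫ x in Ioo 0 1, x / a x * prim f x ^ 2 * (2 - x * a.deriv x / a x) := by
  obtain ⟨M, hM⟩ := isCompact_Icc.exists_bound_of_continuousOn hf
  have hM0 : 0 ≤ M := (norm_nonneg _).trans (hM 0 (by simp))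
  have ha1 : 0 < (a 1)⁻¹ := inv_pos.2 (a.pos 1 (right_mem_Ioc.2 one_pos))
  have cv : ContinuousOn (prim f) (Icc 0 1) :=
    continuousOn_prim (hf.integrableOn_Icc.mono_set Ioo_subset_Icc_self)
  have hv : ∀ x ∈ Icc (0 : ℝ) 1, |prim f x| ≤ M * x := fun x hx => abs_prim_le hM hx
  have ca : ContinuousOn a (Ioo 0 1) := a.continuousOn.mono Ioo_subset_Icc_self
  have ha0 : ∀ x ∈ Ioo (0 : ℝ) 1, a x ≠ 0 := fun x hx => (a.pos x ⟨hx.1, hx.2.le⟩).ne'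
  have cv' := cv.mono Ioo_subset_Icc_self
  have cd := h.continuousOn_deriv
  have hvol : volume (Ioo (0 : ℝ) 1) ≠ ⊤ := by simp
  have i1 : IntegrableOn (fun x => prim f x * (x ^ 2 / a x) * f x) (Ioo 0 1) := by
    refine integrableOn_of_continuousOn_of_abs_le measurableSet_Ioo hvol
      ((cv'.mul ((continuousOn_sq_div a).mono Ioo_subset_Ioc_self)).mul
        (hf.mono Ioo_subset_Icc_self)) (M := M * (a 1)⁻¹ * M) fun x hx => ?_
    have hx' : x ∈ Icc (0 : ℝ) 1 := Ioo_subset_Icc_self hx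
    have hx2 : x ∈ Ioc (0 : ℝ) 1 := ⟨hx.1, hx.2.le⟩
    have h2 : |prim f x| ≤ M := (hv x hx').trans (mul_le_of_le_one_right hM0 hx.2.le)
    have h3 : 0 ≤ x ^ 2 / a x := div_nonneg (sq_nonneg x) (a.pos x hx2).le
    rw [abs_mul, abs_mul, abs_of_nonneg h3]
    exact mul_le_mul (mul_le_mul h2 (h.sq_div_le hx2) h3 hM0) (hM x hx') (abs_nonneg _)
      (mul_nonneg hM0 ha1.le)
  have i2 : IntegrableOn (fun x => x / a x * prim f x ^ 2 * (2 - x * a.deriv x / a x))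
      (Ioo 0 1) := by
    refine integrableOn_of_continuousOn_of_abs_le measurableSet_Ioo hvol ?_
      (M := 4 * (a 1)⁻¹ * M ^ 2) fun x hx => h.abs_weight_le hx (hv x (Ioo_subset_Icc_self hx))
    exact ((continuousOn_id.div ca ha0).mul (cv'.pow 2)).mul
      (continuousOn_const.sub ((continuousOn_id.mul cd).div ca ha0))
  have hle : 𝓝[>] (0 : ℝ) ≤ 𝓝[Icc 0 1] 0 := by
    rw [← nhdsWithin_Ioo_eq_nhdsGT one_pos]
    exact nhdsWithin_mono _ Ioo_subset_Icc_self
  have hle1 : 𝓝[<] (1 : ℝ) ≤ 𝓝[Ioc 0 1] 1 := by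
    rw [← nhdsWithin_Ioo_eq_nhdsLT one_pos]
    exact nhdsWithin_mono _ Ioo_subset_Ioc_self
  have e := intervalIntegral.integral_eq_sub_of_hasDerivAt_of_tendsto
    (f := fun x => x ^ 2 / a x * prim f x ^ 2) (fa := 0) (fb := 0)
    (f' := fun x => 2 * (prim f x * (x ^ 2 / a x) * f x)
      + x / a x * prim f x ^ 2 * (2 - x * a.deriv x / a x)) one_pos
    (fun x hx => by
      have d := ((hasDerivAt_pow 2 x).fun_div (h.hasDerivAt hx) (ha0 x hx)).fun_mul
        ((hasDerivAt_prim hf hx).fun_pow 2)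
      refine d.congr_deriv ?_
      have := ha0 x hx
      simp only [Nat.cast_ofNat, Nat.add_one_sub_one, pow_one]
      field_simp
      ring)
    ((intervalIntegrable_iff_integrableOn_Ioo_of_le zero_le_one).2
      (show Integrable _ _ from (i1.const_mul 2).fun_add i2))
    (by
      have t : Tendsto (fun x => (a 1)⁻¹ * prim f x ^ 2) (𝓝[>] 0) (𝓝 0) := by
        have := ((cv 0 (by simp)).mono_left hle).pow 2 |>.const_mul (a 1)⁻¹
        simpa [prim_zero] using this
      refine squeeze_zero_norm' ?_ t
      filter_upwards [Ioo_mem_nhdsGT one_pos] with x hx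
      have hx2 : x ∈ Ioc (0 : ℝ) 1 := ⟨hx.1, hx.2.le⟩
      have h3 : 0 ≤ x ^ 2 / a x := div_nonneg (sq_nonneg x) (a.pos x hx2).le
      rw [Real.norm_of_nonneg (mul_nonneg h3 (sq_nonneg _))]
      exact mul_le_mul_of_nonneg_right (h.sq_div_le hx2) (sq_nonneg _))
    (by
      have := (((continuousOn_sq_div a).mul ((cv.mono Ioc_subset_Icc_self).pow 2)) 1
        (right_mem_Ioc.2 one_pos)).mono_left hle1
      rw [Pi.mul_apply, Pi.pow_apply, h1, zero_pow two_ne_zero, mul_zero] at this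
      exact this)
  rw [intervalIntegral.integral_of_le zero_le_one, integral_Ioc_eq_integral_Ioo,
    integral_add (i1.const_mul 2) i2, integral_const_mul] at e
  linarith

end Coefficient.IsAdmissible

/-! ### Continuous dependence on the data -/

theorem prim_eq_inner (q : UnitL2) {x : ℝ} (hx : x ∈ Icc (0 : ℝ) 1) :
    prim q x = inner ℝ (indicatorConstLp 2 (measurableSet_Ioo (a := 0) (b := x))
      (measure_ne_top unitMeasure _) (1 : ℝ)) q := by
  rw [L2.inner_indicatorConstLp_one, prim, intervalIntegral.integral_of_le hx.1,
    integral_Ioc_eq_integral_Ioo, Measure.restrict_restrict measurableSet_Ioo,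
    inter_eq_left.2 (Ioo_subset_Ioo_right hx.2)]

theorem abs_prim_coeFn_le (q : UnitL2) {x : ℝ} (hx : x ∈ Icc (0 : ℝ) 1) : |prim q x| ≤ ‖q‖ := by
  have h1 : unitMeasure.real (Ioo 0 x) ≤ 1 := by
    have : unitMeasure.real (Ioo 0 x) ≤ unitMeasure.real univ := measureReal_mono (subset_univ _)
    simpa using this
  have h2 := abs_setIntegral_le q (measurableSet_Ioo (a := 0) (b := x))
    (measure_ne_top unitMeasure _)
  rw [Measure.restrict_restrict measurableSet_Ioo, inter_eq_left.2 (Ioo_subset_Ioo_right hx.2),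
    ← integral_Ioc_eq_integral_Ioo, ← intervalIntegral.integral_of_le hx.1] at h2
  exact h2.trans (mul_le_of_le_one_right (norm_nonneg _) (Real.sqrt_le_one.2 h1))

theorem abs_prim_sub_le (q q' : UnitL2) {x : ℝ} (hx : x ∈ Icc (0 : ℝ) 1) :
    |prim q x - prim q' x| ≤ 1 * ‖q - q'‖ := by
  rw [prim_eq_inner q hx, prim_eq_inner q' hx, ← inner_sub_right, ← prim_eq_inner _ hx, one_mul]
  exact abs_prim_coeFn_le _ hx

theorem hasDerivWithinAt_prim_time {q : ℝ → UnitL2} {q' : UnitL2} {s : Set ℝ} {t : ℝ}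
    (hq : HasDerivWithinAt q q' s t) {x : ℝ} (hx : x ∈ Icc (0 : ℝ) 1) :
    HasDerivWithinAt (fun t => prim (q t) x) (prim q' x) s t := by
  simp only [prim_eq_inner _ hx]
  exact ((innerSL ℝ (indicatorConstLp 2 (measurableSet_Ioo (a := 0) (b := x))
      (measure_ne_top unitMeasure _) (1 : ℝ))).hasFDerivAt.comp_hasDerivWithinAt t hq)

/-- A family of continuous functions of `x`, uniformly Lipschitz in a parameter that moves
continuously in time, is jointly continuous. -/
theorem continuousOn_uncurry_of_lipschitz {E : Type*} [NormedAddCommGroup E] {f : E → ℝ → ℝ}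
    {K : ℝ} {s I : Set ℝ} (hf : ∀ e, ContinuousOn (f e) s)
    (hK : ∀ e e', ∀ x ∈ s, |f e x - f e' x| ≤ K * ‖e - e'‖) {c : ℝ → E} (hc : ContinuousOn c I) :
    ContinuousOn (fun p : ℝ × ℝ => f (c p.1) p.2) (I ×ˢ s) := by
  rintro ⟨t, x⟩ ⟨ht, hx⟩
  have h1 : Tendsto (fun p : ℝ × ℝ => f (c t) p.2) (𝓝[I ×ˢ s] (t, x)) (𝓝 (f (c t) x)) :=
    (hf (c t) x hx).tendsto.comp
      (tendsto_snd.mono_left (nhdsWithin_prod_eq t x I s).le)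
  have h2 : Tendsto (fun p : ℝ × ℝ => c p.1) (𝓝[I ×ˢ s] (t, x)) (𝓝 (c t)) :=
    (hc t ht).tendsto.comp (tendsto_fst.mono_left (nhdsWithin_prod_eq t x I s).le)
  have h3 : Tendsto (fun p : ℝ × ℝ => f (c p.1) p.2 - f (c t) p.2) (𝓝[I ×ˢ s] (t, x)) (𝓝 0) := by
    have h4 : Tendsto (fun p : ℝ × ℝ => K * ‖c p.1 - c t‖) (𝓝[I ×ˢ s] (t, x)) (𝓝 0) := by
      have := (h2.sub_const (c t)).norm.const_mul K
      simpa using this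
    refine squeeze_zero_norm' ?_ h4
    filter_upwards [self_mem_nhdsWithin] with p hp using hK _ _ _ hp.2
  have h5 := h3.add h1
  simp only [sub_add_cancel, zero_add] at h5
  exact h5

theorem hasDerivWithinAt_prim {f : ℝ → ℝ} (hf : ContinuousOn f (Icc 0 1)) {x : ℝ}
    (hx : x ∈ Icc (0 : ℝ) 1) : HasDerivWithinAt (prim f) (f x) (Icc 0 1) x := by
  have : Fact (x ∈ Icc (0 : ℝ) 1) := ⟨hx⟩
  refine intervalIntegral.integral_hasDerivWithinAt_right (intervalIntegrable_unit
    (hf.integrableOn_Icc.mono_set Ioo_subset_Icc_self) (by simp) hx) ?_ (hf x hx)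
  exact ⟨Icc 0 1, self_mem_nhdsWithin, hf.aestronglyMeasurable measurableSet_Icc⟩

/-! ### The multiplier `x²` -/

namespace Coefficient

variable {a : Coefficient}

namespace IsAdmissible

theorem integrable_sq_mul_sq_div (h : a.IsAdmissible) (q : UnitL2) :
    IntegrableOn (fun x => (x ^ 2 * q x) ^ 2 / a x) (Ioo 0 1) ∧
      ∫ x in Ioo 0 1, (x ^ 2 * q x) ^ 2 / a x ≤ (a 1)⁻¹ * ‖q‖ ^ 2 := by
  have hq : Integrable (fun x => q x ^ 2) unitMeasure := (Lp.memLp q).integrable_sq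
  have ha1 : 0 < (a 1)⁻¹ := inv_pos.2 (a.pos 1 (right_mem_Ioc.2 one_pos))
  have hb : ∀ x ∈ Ioo (0 : ℝ) 1, (x ^ 2 * q x) ^ 2 / a x ≤ (a 1)⁻¹ * q x ^ 2 := fun x hx => by
    have hx2 : x ∈ Ioc (0 : ℝ) 1 := ⟨hx.1, hx.2.le⟩
    have h3 : 0 ≤ x ^ 2 / a x := div_nonneg (sq_nonneg x) (a.pos x hx2).le
    have h4 : x ^ 2 ≤ 1 := pow_le_one₀ hx.1.le hx.2.le
    calc (x ^ 2 * q x) ^ 2 / a x = x ^ 2 / a x * (x ^ 2 * q x ^ 2) := by ring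
      _ ≤ (a 1)⁻¹ * (1 * q x ^ 2) := mul_le_mul (h.sq_div_le hx2)
          (mul_le_mul_of_nonneg_right h4 (sq_nonneg _)) (by positivity) ha1.le
      _ = (a 1)⁻¹ * q x ^ 2 := by ring
  have hae : ∀ᵐ x ∂unitMeasure, (x ^ 2 * q x) ^ 2 / a x ≤ (a 1)⁻¹ * q x ^ 2 :=
    (ae_restrict_iff' measurableSet_Ioo).2 (Eventually.of_forall hb)
  have hi : IntegrableOn (fun x => (x ^ 2 * q x) ^ 2 / a x) (Ioo 0 1) := by
    refine Integrable.mono' (hq.const_mul (a 1)⁻¹) ?_ ?_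
    · have h1 : AEStronglyMeasurable (fun x => 1 / a x) unitMeasure :=
        (a.continuousOn_inv.mono Ioo_subset_Ioc_self).aestronglyMeasurable measurableSet_Ioo
      have h2 : AEStronglyMeasurable (fun x : ℝ => x ^ 2) unitMeasure :=
        (continuous_pow 2).aestronglyMeasurable
      refine (((h2.mul (Lp.aestronglyMeasurable q)).pow 2).mul h1).congr
        (Eventually.of_forall fun x => ?_)
      simp only [Pi.mul_apply, Pi.pow_apply]
      ring
    · filter_upwards [hae, (ae_restrict_iff' measurableSet_Ioo).2
        (Eventually.of_forall fun x hx => a.pos x ⟨hx.1, hx.2.le⟩)] with x h1 h2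
      rwa [Real.norm_of_nonneg (div_nonneg (sq_nonneg _) h2.le)]
  refine ⟨hi, (integral_mono_ae hi (hq.const_mul _) hae).trans_eq ?_⟩
  rw [integral_const_mul, ← real_inner_self_eq_norm_sq, L2.inner_def]
  simp [sq]

theorem memLp_sq_mul (h : a.IsAdmissible) (q : UnitL2) :
    MemLp (fun x => x ^ 2 * q x) 2 a.measure := by
  refine (memLp_two_iff_integrable_sq ?_).2
    (a.integrable_measure_iff.2 (h.integrable_sq_mul_sq_div q).1)
  exact ((continuous_pow 2).aestronglyMeasurable.mul (Lp.aestronglyMeasurable q)).mono_ac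
    a.measure_absolutelyContinuous

/-- Multiplication by `x²`, a bounded operator from `L²(0,1)` to `L²_{1/a}(0,1)` because `x² / a` is
bounded. -/
noncomputable def mulSq (h : a.IsAdmissible) : UnitL2 →L[ℝ] a.L2 :=
  LinearMap.mkContinuous
    { toFun := fun q => (h.memLp_sq_mul q).toLp
      map_add' := fun q q' => by
        rw [← MemLp.toLp_add]
        refine MemLp.toLp_congr _ _ (a.measure_absolutelyContinuous.ae_eq ?_)
        filter_upwards [Lp.coeFn_add q q'] with x hx
        simp only [hx, Pi.add_apply]
        ring
      map_smul' := fun c q => by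
        rw [RingHom.id_apply, ← MemLp.toLp_const_smul]
        refine MemLp.toLp_congr _ _ (a.measure_absolutelyContinuous.ae_eq ?_)
        filter_upwards [Lp.coeFn_smul c q] with x hx
        simp only [hx, Pi.smul_apply, smul_eq_mul]
        ring }
    (Real.sqrt (a 1)⁻¹) fun q => by
      have ha1 : 0 < (a 1)⁻¹ := inv_pos.2 (a.pos 1 (right_mem_Ioc.2 one_pos))
      refine abs_le_of_sq_le_sq' ?_ (by positivity) |>.2
      rw [mul_pow, Real.sq_sqrt ha1.le, ← real_inner_self_eq_norm_sq, L2.inner_def]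
      refine le_of_eq_of_le ?_ (h.integrable_sq_mul_sq_div q).2
      rw [← a.integral_measure]
      refine integral_congr_ae ?_
      filter_upwards [MemLp.coeFn_toLp (h.memLp_sq_mul q)] with x hx
      simp only [LinearMap.coe_mk, AddHom.coe_mk, hx]
      rw [real_inner_self_eq_norm_sq, Real.norm_eq_abs, sq_abs]

theorem coeFn_mulSq (h : a.IsAdmissible) (q : UnitL2) :
    h.mulSq q =ᵐ[a.measure] fun x => x ^ 2 * q x :=
  MemLp.coeFn_toLp (h.memLp_sq_mul q)

theorem integrableOn_mul_sq_div_mul (h : a.IsAdmissible) (v : a.L2) (q : UnitL2) :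
    IntegrableOn (fun x => v x * (x ^ 2 / a x) * q x) (Ioo 0 1) := by
  have h1 := a.integrable_measure_iff.1 ((Lp.memLp v).integrable_mul (h.memLp_sq_mul q))
  refine h1.congr (Eventually.of_forall fun x => ?_)
  simp only [Pi.mul_apply]
  ring

theorem inner_mulSq (h : a.IsAdmissible) (v : a.L2) (q : UnitL2) :
    inner ℝ v (h.mulSq q) = ∫ x in Ioo 0 1, v x * (x ^ 2 / a x) * q x := by
  have h1 : ∫ x, inner ℝ (v x) (h.mulSq q x) ∂a.measure = ∫ x, v x * (x ^ 2 * q x) ∂a.measure := by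
    refine integral_congr_ae ?_
    filter_upwards [h.coeFn_mulSq q] with x hx
    rw [hx, real_inner_eq_re_inner, RCLike.inner_apply]
    simp
    ring
  rw [L2.inner_def, h1, a.integral_measure]
  refine integral_congr_ae (Eventually.of_forall fun x => ?_)
  simp only
  ring

end IsAdmissible

end Coefficient

theorem Ioo_prod_Ioo_subset (T : ℝ) :
    (Ioo 0 T ×ˢ Ioo 0 1 : Set (ℝ × ℝ)) ⊆ Ici 0 ×ˢ Icc 0 1 :=
  prod_mono (fun _ ht => ht.1.le) Ioo_subset_Icc_self

theorem volume_Ioo_prod_Ioo_ne_top (T : ℝ) :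
    volume (Ioo 0 T ×ˢ Ioo 0 1 : Set (ℝ × ℝ)) ≠ ⊤ := by
  rw [Measure.volume_eq_prod, Measure.prod_prod]
  simp

/-! ### Classical solutions -/

/-- The curves `u₁ = y_x`, `v = y_t`, `v₁ = y_tx`, `v₂ = y_txx`, `w = A y` attached to a classical
solution `y`, with the relations between them. -/
structure Coefficient.IsRepresentation (a : Coefficient) (y : ℝ → ℝ → ℝ) (u₁ : ℝ → UnitL2)
    (v : ℝ → a.L2) (v₁ v₂ : ℝ → UnitL2) (w : ℝ → a.L2) : Prop where
  eq_prim : ∀ t, 0 ≤ t → ∀ x ∈ Icc (0 : ℝ) 1, y t x = prim (u₁ t) x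
  space_ae : ∀ t, 0 ≤ t → u₁ t =ᵐ[unitMeasure] prim (a.bending (w t))
  space_one : ∀ t, 0 ≤ t → prim (a.bending (w t)) 1 = 0
  velocity_ae : ∀ t, 0 ≤ t → v t =ᵐ[unitMeasure] prim (v₁ t)
  velocity_one : ∀ t, 0 ≤ t → prim (v₁ t) 1 = 0
  velocity_space_ae : ∀ t, 0 ≤ t → v₁ t =ᵐ[unitMeasure] prim (v₂ t)
  hasDerivWithinAt_space : ∀ t, 0 ≤ t → HasDerivWithinAt u₁ (v₁ t) (Ici 0) t
  hasDerivWithinAt_velocity : ∀ t, 0 ≤ t → HasDerivWithinAt v (-w t) (Ici 0) t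
  continuousOn_velocity_space : ContinuousOn v₁ (Ici 0)
  continuousOn_velocity_space_two : ContinuousOn v₂ (Ici 0)
  continuousOn_load : ContinuousOn w (Ici 0)

theorem Coefficient.IsClassicalSolution.exists_representation {a : Coefficient}
    (h : a.IsAdmissible) {y₀ y₁ : ℝ → ℝ} {y : ℝ → ℝ → ℝ} (hy : a.IsClassicalSolution y₀ y₁ y) :
    ∃ u₁ v v₁ v₂ w, a.IsRepresentation y u₁ v v₁ v₂ w := by
  obtain ⟨hcont, Y, Z, W, hYy, hZY, hWZ, hY2, hZ1, hWc, heq, -, -⟩ := hy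
  have hU := uniqueDiffOn_Ici (0 : ℝ)
  set Z' : ℝ → a.H2 := derivWithin Z (Ici 0)
  have dZ : ∀ t, 0 ≤ t → HasDerivWithinAt Z (Z' t) (Ici 0) t := fun t ht =>
    (hZ1.differentiableOn one_ne_zero t ht).hasDerivWithinAt
  have cZ' : ContinuousOn Z' (Ici 0) := hZ1.continuousOn_derivWithin hU le_rfl
  let π₀ : a.H2 →L[ℝ] a.L2 := (ContinuousLinearMap.fst ℝ a.L2 (UnitL2 × UnitL2)).comp a.H2.subtypeL
  let π₁ : a.H2 →L[ℝ] UnitL2 := ((ContinuousLinearMap.fst ℝ UnitL2 UnitL2).comp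
    (ContinuousLinearMap.snd ℝ a.L2 (UnitL2 × UnitL2))).comp a.H2.subtypeL
  let π₂ : a.H2 →L[ℝ] UnitL2 := ((ContinuousLinearMap.snd ℝ UnitL2 UnitL2).comp
    (ContinuousLinearMap.snd ℝ a.L2 (UnitL2 × UnitL2))).comp a.H2.subtypeL
  -- the velocity computed in `L²_{1/a}` agrees with the one computed in `H²_{1/a}`
  have hV : ∀ t ∈ Ici (0 : ℝ), derivWithin Y (Ici 0) t = π₀ (Z' t) := fun t ht => by
    have h1 : HasDerivWithinAt (fun t => π₀ (Z t)) (π₀ (Z' t)) (Ici 0) t :=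
      π₀.hasFDerivAt.comp_hasDerivWithinAt t (dZ t ht)
    exact (h1.congr (fun s hs => (hZY s hs).symm) (hZY t ht).symm).derivWithin (hU t ht)
  have dV : ∀ t, 0 ≤ t → HasDerivWithinAt (fun t => π₀ (Z' t)) (-(W t).1.2) (Ici 0) t := by
    intro t ht
    have h1 : DifferentiableOn ℝ (derivWithin Y (Ici 0)) (Ici 0) :=
      ((contDiffOn_succ_iff_derivWithin (n := 1) hU).1 hY2).2.2.differentiableOn one_ne_zero
    have h2 := (h1 t ht).hasDerivWithinAt
    have h3 : derivWithin (derivWithin Y (Ici 0)) (Ici 0) t = -(W t).1.2 := by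
      have h4 := heq t ht
      rw [iteratedDerivWithin_succ, iteratedDerivWithin_one] at h4
      exact eq_neg_of_add_eq_zero_left h4
    rw [h3] at h2
    exact h2.congr (fun s hs => (hV s hs).symm) (hV t ht).symm
  have hZp := fun t => H2_ae_eq_prim (Z t).2
  have hZp' := fun t => H2_ae_eq_prim (Z' t).2
  have hB : ∀ t, 0 ≤ t → (Z t).1.2.2 =ᵐ[unitMeasure] a.bending (W t).1.2 := fun t ht => by
    rw [← hWZ t ht]
    exact h.ae_eq_bending (W t)
  refine ⟨fun t => π₁ (Z t), fun t => π₀ (Z' t), fun t => π₁ (Z' t), fun t => π₂ (Z' t),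
    fun t => (W t).1.2, ?_, ?_, ?_, ?_, ?_, ?_, ?_, dV, ?_, ?_, ?_⟩
  · intro t ht
    refine eqOn_of_ae_eq_unit ?_ (hcont t ht) (continuousOn_prim (π₁ (Z t)).integrable)
    refine (hYy t ht).symm.trans ?_
    rw [← hZY t ht]
    exact (hZp t).2.1
  · intro t ht
    refine (hZp t).1.1.trans ((ae_restrict_iff' measurableSet_Ioo).2
      (Eventually.of_forall fun x hx => ?_))
    exact prim_congr (hB t ht) (Ioo_subset_Icc_self hx)
  · intro t ht
    exact (prim_congr (hB t ht) (x := 1) (by simp)).symm.trans (hZp t).1.2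
  · exact fun t _ => (hZp' t).2.1
  · exact fun t _ => (hZp' t).2.2
  · exact fun t _ => (hZp' t).1.1
  · exact fun t ht => π₁.hasFDerivAt.comp_hasDerivWithinAt t (dZ t ht)
  · exact π₁.continuous.comp_continuousOn cZ'
  · exact π₂.continuous.comp_continuousOn cZ'
  · exact (continuous_snd.comp continuous_subtype_val).comp_continuousOn hWc

namespace Coefficient.IsRepresentation

variable {a : Coefficient} {y : ℝ → ℝ → ℝ} {u₁ : ℝ → UnitL2} {v : ℝ → a.L2}
  {v₁ v₂ : ℝ → UnitL2} {w : ℝ → a.L2} {t x : ℝ}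

theorem eqOn_prim_prim (R : a.IsRepresentation y u₁ v v₁ v₂ w) (ht : 0 ≤ t) :
    EqOn (y t) (prim (prim (a.bending (w t)))) (Icc 0 1) := fun x hx => by
  rw [R.eq_prim t ht x hx, prim_congr (R.space_ae t ht) hx]

theorem dx_eq (R : a.IsRepresentation y u₁ v v₁ v₂ w) (h : a.IsAdmissible) (ht : 0 ≤ t)
    (hx : x ∈ Icc (0 : ℝ) 1) : dx y t x = prim (a.bending (w t)) x := by
  have hE := R.eqOn_prim_prim ht
  refine HasDerivWithinAt.derivWithin ?_ (uniqueDiffOn_Icc one_pos x hx)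
  exact (hasDerivWithinAt_prim (continuousOn_prim (h.integrable_bending _)) hx).congr hE (hE hx)

theorem dxx_eq (R : a.IsRepresentation y u₁ v v₁ v₂ w) (h : a.IsAdmissible) (ht : 0 ≤ t)
    (hx : x ∈ Icc (0 : ℝ) 1) : dxx y t x = a.bending (w t) x := by
  have hE : EqOn (dx y t) (prim (a.bending (w t))) (Icc 0 1) := fun z hz => R.dx_eq h ht hz
  refine HasDerivWithinAt.derivWithin ?_ (uniqueDiffOn_Icc one_pos x hx)
  exact (hasDerivWithinAt_prim (h.continuousOn_bending _) hx).congr hE (hE hx)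

theorem hasDerivWithinAt_time (R : a.IsRepresentation y u₁ v v₁ v₂ w) (ht : 0 ≤ t)
    (hx : x ∈ Icc (0 : ℝ) 1) :
    HasDerivWithinAt (fun s => y s x) (prim (v₁ t) x) (Ici 0) t :=
  (hasDerivWithinAt_prim_time (R.hasDerivWithinAt_space t ht) hx).congr
    (fun s hs => R.eq_prim s hs x hx) (R.eq_prim t ht x hx)

theorem dt_eq (R : a.IsRepresentation y u₁ v v₁ v₂ w) (ht : 0 ≤ t)
    (hx : x ∈ Icc (0 : ℝ) 1) : dt y t x = prim (v₁ t) x :=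
  (R.hasDerivWithinAt_time ht hx).derivWithin (uniqueDiffOn_Ici 0 t ht)

/-- Since `y_xx(t,·)` is the bending moment, `y(t,·)` is even of class `C²` up to `0`. -/
theorem contDiffOn (R : a.IsRepresentation y u₁ v v₁ v₂ w) (h : a.IsAdmissible) (ht : 0 ≤ t) :
    ContDiffOn ℝ 2 (y t) (Icc 0 1) := by
  have hU := uniqueDiffOn_Icc (one_pos (α := ℝ))
  have hB := h.continuousOn_bending (w t)
  have step : ∀ {n : ℕ} {f : ℝ → ℝ}, ContDiffOn ℝ n f (Icc 0 1) →
      ContDiffOn ℝ (n + 1) (prim f) (Icc 0 1) := fun {n f} hf => by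
    have hd := fun x hx => hasDerivWithinAt_prim hf.continuousOn (x := x) hx
    refine (contDiffOn_succ_iff_derivWithin hU).2
      ⟨fun x hx => (hd x hx).differentiableWithinAt, by simp, hf.congr fun x hx => ?_⟩
    exact (hd x hx).derivWithin (hU x hx)
  have h2 := step (n := 1) (by exact_mod_cast step (n := 0) (contDiffOn_zero.2 hB))
  have h3 : ContDiffOn ℝ 2 (prim (prim (a.bending (w t)))) (Icc 0 1) := by
    convert h2 using 1
    norm_num
  exact h3.congr (R.eqOn_prim_prim ht)

/-- The rate of change of `∫ y_t (x² / a) y_x`. -/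
theorem hasDerivWithinAt_inner (R : a.IsRepresentation y u₁ v v₁ v₂ w) (h : a.IsAdmissible)
    (ht : 0 ≤ t) :
    HasDerivWithinAt (fun s => inner ℝ (v s) (h.mulSq (u₁ s)))
      (inner ℝ (v t) (h.mulSq (v₁ t)) + inner ℝ (-w t) (h.mulSq (u₁ t))) (Ici 0) t :=
  (R.hasDerivWithinAt_velocity t ht).inner ℝ
    (h.mulSq.hasFDerivAt.comp_hasDerivWithinAt t (R.hasDerivWithinAt_space t ht))

theorem continuousOn_inner_deriv (R : a.IsRepresentation y u₁ v v₁ v₂ w) (h : a.IsAdmissible) :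
    ContinuousOn (fun t => inner ℝ (v t) (h.mulSq (v₁ t)) + inner ℝ (-w t) (h.mulSq (u₁ t)))
      (Ici 0) := by
  have c1 : ContinuousOn v (Ici 0) := fun t ht =>
    (R.hasDerivWithinAt_velocity t ht).continuousWithinAt
  have c2 : ContinuousOn u₁ (Ici 0) := fun t ht =>
    (R.hasDerivWithinAt_space t ht).continuousWithinAt
  exact (c1.inner (𝕜 := ℝ) (h.mulSq.continuous.comp_continuousOn
    R.continuousOn_velocity_space)).add
    (R.continuousOn_load.neg.inner (𝕜 := ℝ) (h.mulSq.continuous.comp_continuousOn c2))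

/-- The kinetic part `∫ y_t (x² / a) y_tx` of the rate of change. -/
theorem inner_velocity (R : a.IsRepresentation y u₁ v v₁ v₂ w) (h : a.IsAdmissible)
    (ht : 0 ≤ t) : inner ℝ (v t) (h.mulSq (v₁ t))
      = -(1 / 2) * ∫ x in Ioo 0 1, x / a x * prim (v₁ t) x ^ 2 * (2 - x * a.deriv x / a x) := by
  have hc : ∀ x ∈ Icc (0 : ℝ) 1, prim (v₁ t) x = prim (prim (v₂ t)) x := fun x hx =>
    prim_congr (R.velocity_space_ae t ht) hx
  have e := h.integral_mul_sq_div_mul_deriv (f := prim (v₂ t))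
    (continuousOn_prim (v₂ t).integrable) (by rw [← hc 1 (by simp), R.velocity_one t ht])
  have e1 : ∫ x in Ioo 0 1, x / a x * prim (prim (v₂ t)) x ^ 2 * (2 - x * a.deriv x / a x)
      = ∫ x in Ioo 0 1, x / a x * prim (v₁ t) x ^ 2 * (2 - x * a.deriv x / a x) :=
    setIntegral_congr_fun measurableSet_Ioo fun x hx => by
      simp only [hc x (Ioo_subset_Icc_self hx)]
  rw [h.inner_mulSq, ← e1, ← e]
  refine integral_congr_ae ?_
  filter_upwards [R.velocity_ae t ht, R.velocity_space_ae t ht,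
    ae_restrict_mem measurableSet_Ioo] with x h1 h2 h3
  rw [h1, h2, hc x (Ioo_subset_Icc_self h3)]

/-- The elastic part `∫ y_tt (x² / a) y_x` of the rate of change, where `y_tt = -A y`. -/
theorem inner_load (R : a.IsRepresentation y u₁ v v₁ v₂ w) (h : a.IsAdmissible)
    (ht : 0 ≤ t) : inner ℝ (-w t) (h.mulSq (u₁ t))
      = a.bending (w t) 1 ^ 2 / 2 - 3 * ∫ x in Ioo 0 1, x * a.bending (w t) x ^ 2 := by
  have hae : (fun x => w t x * (x ^ 2 / a x) * u₁ t x) =ᵐ[unitMeasure]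
      fun x => w t x / a x * (x ^ 2 * prim (a.bending (w t)) x) := by
    filter_upwards [R.space_ae t ht] with x hx
    rw [hx]
    ring
  rw [inner_neg_left, h.inner_mulSq, integral_congr_ae hae, h.integral_load_mul (w t)
    (R.space_one t ht) ((h.integrableOn_mul_sq_div_mul (w t) (u₁ t)).congr hae)]
  ring

theorem inner_eq_integral (R : a.IsRepresentation y u₁ v v₁ v₂ w) (h : a.IsAdmissible)
    (ht : 0 ≤ t) :
    IntegrableOn (fun x => dt y t x * (x ^ 2 / a x) * dx y t x) (Ioo 0 1) ∧
      ∫ x in Ioo 0 1, dt y t x * (x ^ 2 / a x) * dx y t x = inner ℝ (v t) (h.mulSq (u₁ t)) := by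
  have hae : (fun x => v t x * (x ^ 2 / a x) * u₁ t x) =ᵐ[unitMeasure]
      fun x => dt y t x * (x ^ 2 / a x) * dx y t x := by
    filter_upwards [R.space_ae t ht, R.velocity_ae t ht, ae_restrict_mem measurableSet_Ioo]
      with x h1 h2 h3
    rw [h1, h2, R.dt_eq ht (Ioo_subset_Icc_self h3), R.dx_eq h ht (Ioo_subset_Icc_self h3)]
  exact ⟨(h.integrableOn_mul_sq_div_mul (v t) (u₁ t)).congr hae, by
    rw [h.inner_mulSq, integral_congr_ae hae]⟩

theorem continuousOn_bending (R : a.IsRepresentation y u₁ v v₁ v₂ w) (h : a.IsAdmissible) :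
    ContinuousOn (fun p : ℝ × ℝ => a.bending (w p.1) p.2) (Ici 0 ×ˢ Icc 0 1) :=
  continuousOn_uncurry_of_lipschitz (f := fun e : a.L2 => a.bending e)
    (fun e => h.continuousOn_bending e)
    (fun e e' _ hx => h.abs_bending_sub_le e e' hx) R.continuousOn_load

theorem continuousOn_velocity (R : a.IsRepresentation y u₁ v v₁ v₂ w) :
    ContinuousOn (fun p : ℝ × ℝ => prim (v₁ p.1) p.2) (Ici 0 ×ˢ Icc 0 1) :=
  continuousOn_uncurry_of_lipschitz (f := fun e : UnitL2 => prim e)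
    (fun e => continuousOn_prim e.integrable)
    (fun e e' _ hx => abs_prim_sub_le e e' hx) R.continuousOn_velocity_space

theorem integrableOn_bending (R : a.IsRepresentation y u₁ v v₁ v₂ w) (h : a.IsAdmissible)
    (T : ℝ) :
    IntegrableOn (fun p : ℝ × ℝ => p.2 * a.bending (w p.1) p.2 ^ 2) (Ioo 0 T ×ˢ Ioo 0 1) := by
  obtain ⟨M, hM⟩ := isCompact_Icc.exists_bound_of_continuousOn
    (R.continuousOn_load.mono (fun _ (ht : _ ∈ Icc 0 T) => ht.1))
  refine integrableOn_of_continuousOn_of_abs_le (measurableSet_Ioo.prod measurableSet_Ioo)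
    (volume_Ioo_prod_Ioo_ne_top T)
    (continuousOn_snd.mul (((R.continuousOn_bending h).mono (Ioo_prod_Ioo_subset T)).pow 2))
    (M := (22 * Real.sqrt (a 1)⁻¹ * M) ^ 2) fun p hp => ?_
  have h1 := h.abs_bending_le (w p.1) (Ioo_subset_Icc_self hp.2)
  have h2 : |a.bending (w p.1) p.2| ≤ 22 * Real.sqrt (a 1)⁻¹ * M :=
    h1.trans (mul_le_mul_of_nonneg_left (hM p.1 (Ioo_subset_Icc_self hp.1)) (by positivity))
  rw [abs_mul, abs_of_pos hp.2.1, abs_pow]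
  calc p.2 * |a.bending (w p.1) p.2| ^ 2 ≤ 1 * |a.bending (w p.1) p.2| ^ 2 :=
        mul_le_mul_of_nonneg_right hp.2.2.le (sq_nonneg _)
    _ ≤ (22 * Real.sqrt (a 1)⁻¹ * M) ^ 2 := by
        rw [one_mul]
        exact pow_le_pow_left₀ (abs_nonneg _) h2 2

theorem integrableOn_velocity (R : a.IsRepresentation y u₁ v v₁ v₂ w) (h : a.IsAdmissible)
    (T : ℝ) :
    IntegrableOn (fun p : ℝ × ℝ => p.2 / a p.2 * prim (v₁ p.1) p.2 ^ 2
      * (2 - p.2 * a.deriv p.2 / a p.2)) (Ioo 0 T ×ˢ Ioo 0 1) := by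
  obtain ⟨M, hM⟩ := isCompact_Icc.exists_bound_of_continuousOn
    (R.continuousOn_velocity_space_two.mono (fun _ (ht : _ ∈ Icc 0 T) => ht.1))
  have hmap : MapsTo Prod.snd (Ioo 0 T ×ˢ Ioo 0 1 : Set (ℝ × ℝ)) (Ioo 0 1) := fun p hp => hp.2
  have ca : ContinuousOn (fun p : ℝ × ℝ => a p.2) (Ioo 0 T ×ˢ Ioo 0 1) :=
    (a.continuousOn.mono Ioo_subset_Icc_self).comp continuousOn_snd hmap
  have cd : ContinuousOn (fun p : ℝ × ℝ => a.deriv p.2) (Ioo 0 T ×ˢ Ioo 0 1) :=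
    h.continuousOn_deriv.comp continuousOn_snd hmap
  have ha0 : ∀ p ∈ (Ioo 0 T ×ˢ Ioo 0 1 : Set (ℝ × ℝ)), a p.2 ≠ 0 := fun p hp =>
    (a.pos p.2 ⟨hp.2.1, hp.2.2.le⟩).ne'
  refine integrableOn_of_continuousOn_of_abs_le (measurableSet_Ioo.prod measurableSet_Ioo)
    (volume_Ioo_prod_Ioo_ne_top T) ?_ (M := 4 * (a 1)⁻¹ * M ^ 2) fun p hp => ?_
  · exact ((continuousOn_snd.div ca ha0).mul ((R.continuousOn_velocity.mono
      (Ioo_prod_Ioo_subset T)).pow 2)).mul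
      (continuousOn_const.sub ((continuousOn_snd.mul cd).div ca ha0))
  · refine h.abs_weight_le hp.2 ?_
    rw [prim_congr (R.velocity_space_ae p.1 hp.1.1.le) (Ioo_subset_Icc_self hp.2)]
    exact abs_prim_le (fun z hz => (abs_prim_coeFn_le _ hz).trans
      (hM p.1 (Ioo_subset_Icc_self hp.1))) (Ioo_subset_Icc_self hp.2)

theorem continuousOn_bending_one (R : a.IsRepresentation y u₁ v v₁ v₂ w) (h : a.IsAdmissible) :
    ContinuousOn (fun t => a.bending (w t) 1) (Ici 0) :=
  (R.continuousOn_bending h).comp (f := fun t : ℝ => (t, (1 : ℝ)))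
    (continuousOn_id.prodMk continuousOn_const) fun _ ht => ⟨ht, by simp⟩

/-- The integrated form of the multiplier identity. -/
theorem inner_sub_inner (R : a.IsRepresentation y u₁ v v₁ v₂ w) (h : a.IsAdmissible) {T : ℝ}
    (hT : 0 < T) :
    inner ℝ (v T) (h.mulSq (u₁ T)) - inner ℝ (v 0) (h.mulSq (u₁ 0))
      = 1 / 2 * (∫ t in Ioo 0 T, a.bending (w t) 1 ^ 2)
        - 1 / 2 * (∫ p in Ioo 0 T ×ˢ Ioo 0 1, p.2 / a p.2 * prim (v₁ p.1) p.2 ^ 2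
            * (2 - p.2 * a.deriv p.2 / a p.2))
        - 3 * ∫ p in Ioo 0 T ×ˢ Ioo 0 1, p.2 * a.bending (w p.1) p.2 ^ 2 := by
  have hsub : Icc 0 T ⊆ Ici 0 := Icc_subset_Ici_self
  have hc := (R.continuousOn_inner_deriv h).mono hsub
  have ftc := intervalIntegral.integral_eq_sub_of_hasDerivAt_of_le hT.le
    (fun t ht => (R.hasDerivWithinAt_inner h ht.1).continuousWithinAt.mono hsub)
    (fun t ht => (R.hasDerivWithinAt_inner h ht.1.le).hasDerivAt (Ici_mem_nhds ht.1))
    (hc.intervalIntegrable_of_Icc hT.le)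
  have i0 : IntegrableOn (fun t => a.bending (w t) 1 ^ 2) (Ioo 0 T) :=
    (((R.continuousOn_bending_one h).pow 2).mono hsub).integrableOn_Icc.mono_set
      Ioo_subset_Icc_self
  have p1 := R.integrableOn_velocity h T
  have p2 := R.integrableOn_bending h T
  rw [Measure.volume_eq_prod] at p1 p2
  have e1 := setIntegral_prod _ p1
  have e2 := setIntegral_prod _ p2
  rw [IntegrableOn, ← Measure.prod_restrict] at p1 p2
  have i1 := p1.integral_prod_left
  have i2 := p2.integral_prod_left
  have i3 : Integrable (fun t => 1 / 2 * a.bending (w t) 1 ^ 2 - 1 / 2 * ∫ x in Ioo 0 1,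
      x / a x * prim (v₁ t) x ^ 2 * (2 - x * a.deriv x / a x)) (volume.restrict (Ioo 0 T)) :=
    (i0.const_mul (1 / 2)).sub (i1.const_mul (1 / 2))
  rw [Measure.volume_eq_prod, e1, e2, ← ftc, intervalIntegral.integral_of_le hT.le,
    integral_Ioc_eq_integral_Ioo, ← integral_const_mul, ← integral_const_mul,
    ← integral_const_mul, ← integral_sub (i0.const_mul _) (i1.const_mul _),
    ← integral_sub i3 (i2.const_mul _)]
  refine setIntegral_congr_fun measurableSet_Ioo fun t ht => ?_
  simp only [R.inner_velocity h ht.1.le, R.inner_load h ht.1.le]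
  ring

end Coefficient.IsRepresentation

end DegenerateBeam

theorem mainTheorem8 (a : DegenerateBeam.Coefficient)
    (ha : a.WeaklyDegenerate ∨ a.StronglyDegenerate)
    (y₀ y₁ : ℝ → ℝ) (y : ℝ → ℝ → ℝ) (hy : a.IsClassicalSolution y₀ y₁ y) :
    -- the derivatives that occur below exist in the classical sense
    (∀ x ∈ Icc (0 : ℝ) 1, DifferentiableOn ℝ (fun t => y t x) (Ici 0)) ∧
    (∀ t, 0 ≤ t → ContDiffOn ℝ 2 (y t) (Ioc 0 1)) ∧
    ∀ T : ℝ, 0 < T →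
      MemLp (fun t => DegenerateBeam.dxx y t 1) 2 (volume.restrict (Ioo 0 T)) ∧
      -- the integrals on the right-hand side converge
      IntegrableOn (fun x => DegenerateBeam.dt y T x * (x ^ 2 / a x) * DegenerateBeam.dx y T x
          - DegenerateBeam.dt y 0 x * (x ^ 2 / a x) * DegenerateBeam.dx y 0 x) (Ioo 0 1) ∧
      IntegrableOn (fun p : ℝ × ℝ => p.2 / a p.2 * DegenerateBeam.dt y p.1 p.2 ^ 2
          * (2 - p.2 * a.deriv p.2 / a p.2)) (Ioo 0 T ×ˢ Ioo 0 1) ∧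
      IntegrableOn (fun p : ℝ × ℝ => p.2 * DegenerateBeam.dxx y p.1 p.2 ^ 2)
          (Ioo 0 T ×ˢ Ioo 0 1) ∧
      1 / 2 * (∫ t in Ioo 0 T, DegenerateBeam.dxx y t 1 ^ 2)
        = (∫ x in Ioo 0 1,
            (DegenerateBeam.dt y T x * (x ^ 2 / a x) * DegenerateBeam.dx y T x
              - DegenerateBeam.dt y 0 x * (x ^ 2 / a x) * DegenerateBeam.dx y 0 x))
          + 1 / 2 * (∫ p in Ioo 0 T ×ˢ Ioo 0 1, p.2 / a p.2 * DegenerateBeam.dt y p.1 p.2 ^ 2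
              * (2 - p.2 * a.deriv p.2 / a p.2))
          + 3 * (∫ p in Ioo 0 T ×ˢ Ioo 0 1, p.2 * DegenerateBeam.dxx y p.1 p.2 ^ 2) := by
  have h := DegenerateBeam.Coefficient.IsAdmissible.of_degenerate ha
  obtain ⟨u₁, v, v₁, v₂, w, R⟩ := hy.exists_representation h
  refine ⟨fun x hx t ht => (R.hasDerivWithinAt_time ht hx).differentiableWithinAt,
    fun t ht => (R.contDiffOn h ht).mono Ioc_subset_Icc_self, fun T hT => ?_⟩
  have h1 : (1 : ℝ) ∈ Icc (0 : ℝ) 1 := by simp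
  have e1 : EqOn (fun t => DegenerateBeam.dxx y t 1) (fun t => a.bending (w t) 1) (Ioo 0 T) :=
    fun t ht => R.dxx_eq h ht.1.le h1
  have e2 : EqOn (fun p : ℝ × ℝ => p.2 / a p.2 * DegenerateBeam.dt y p.1 p.2 ^ 2
      * (2 - p.2 * a.deriv p.2 / a p.2)) (fun p => p.2 / a p.2
      * DegenerateBeam.prim (v₁ p.1) p.2 ^ 2 * (2 - p.2 * a.deriv p.2 / a p.2))
      (Ioo 0 T ×ˢ Ioo 0 1) := fun p hp => by
    simp only [R.dt_eq hp.1.1.le (Ioo_subset_Icc_self hp.2)]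
  have e3 : EqOn (fun p : ℝ × ℝ => p.2 * DegenerateBeam.dxx y p.1 p.2 ^ 2)
      (fun p => p.2 * a.bending (w p.1) p.2 ^ 2) (Ioo 0 T ×ˢ Ioo 0 1) := fun p hp => by
    simp only [R.dxx_eq h hp.1.1.le (Ioo_subset_Icc_self hp.2)]
  have hm : MeasurableSet (Ioo 0 T ×ˢ Ioo 0 1 : Set (ℝ × ℝ)) :=
    measurableSet_Ioo.prod measurableSet_Ioo
  obtain ⟨iT, eT⟩ := R.inner_eq_integral h hT.le
  obtain ⟨i0, e0⟩ := R.inner_eq_integral h le_rfl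
  have c1 := (R.continuousOn_bending_one h).mono (fun _ (ht : _ ∈ Icc 0 T) => ht.1)
  refine ⟨?_, iT.sub i0, (integrableOn_congr_fun e2 hm).2 (R.integrableOn_velocity h T),
    (integrableOn_congr_fun e3 hm).2 (R.integrableOn_bending h T), ?_⟩
  · have hL : MemLp (fun t => a.bending (w t) 1) 2 (volume.restrict (Ioo 0 T)) :=
      (memLp_two_iff_integrable_sq
        ((c1.mono Ioo_subset_Icc_self).aestronglyMeasurable measurableSet_Ioo)).2
        ((c1.pow 2).integrableOn_Icc.mono_set Ioo_subset_Icc_self)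
    exact hL.ae_eq ((ae_restrict_iff' measurableSet_Ioo).2
      (Eventually.of_forall fun t ht => (e1 ht).symm))
  · have e4 : ∫ t in Ioo 0 T, DegenerateBeam.dxx y t 1 ^ 2
        = ∫ t in Ioo 0 T, a.bending (w t) 1 ^ 2 :=
      setIntegral_congr_fun measurableSet_Ioo fun t ht => by simp only [R.dxx_eq h ht.1.le h1]
    rw [integral_sub iT i0, eT, e0, e4, setIntegral_congr_fun hm e2, setIntegral_congr_fun hm e3]
    linarith [R.inner_sub_inner h hT]
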